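/- Let $\sigma:\mathbb N^{\mathbb Z}\to\mathbb N^{\mathbb Z}$, $\sigma(x)_i=x_{i+1}$, be the shift. A \emph{$\mathbb Z$-subshift} is a compact set $X\subset\mathbb N^{\mathbb Z}$ (product topology, $\mathbb N$ discrete) with $\sigma(X)=X$; by compactness, $X\subset S^{\mathbb Z}$ for some finite $S\subset\mathbb N$. It is \emph{quasiminimal} if it has only finitely many proper subshifts (subshifts $Y\subsetneq X$), and \emph{$\Pi^0_1$} if the set of words over $\mathbb N$ that do not occur in any point of $X$ is recursively enumerable. A clopen set is presented by an integer $i$ and a finite list $C=(w_1,\dots,w_r)$ of words, which stand for $[C]_i=\{x : x_{i}x_{i+1}\cdots x_{i+|w_s|-1}=w_s\text{ for some }s\}$. Let $X$ be a quasiminimal $\Pi^0_1$ $\mathbb Z$-subshift. Then the following problems are decidable. (1) \emph{The model-checking problem of $X$ for elementary piecewise testable languages:} given $m\in\mathbb N$, clopen sets $D_0,\dots,D_{m-1}$ whose intersections with $X$ are pairwise disjoint and cover $X$, and letters $a_1,\dots,a_k\in A=\{0,\dots,m-1\}$ with $k\ge 1$, decide whether there are a word $w$ in the language $a_1A^*a_2A^*\cdots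 A^*a_k$ and a point $x\in X$ such that $\sigma^i(x)\in D_{w_i}$ for all $0\le i<|w|$. (2) Given a finite tuple $(D_1,\dots,D_\ell)$ of clopen sets, decide whether some point of $X$ visits them in order, that is, whether there are $x\in X$ and integers $i_1<i_2<\dots<i_\ell$ with $\sigma^{i_j}(x)\in D_j$ for all $1\le j\le\ell$. (3) \emph{The halting problem of $X$:} given two clopen sets $D,E$, decide whether there are $x\in X$ and $j\in\mathbb N=\{0,1,2,\dots\}$ with $x\in D$ and $\sigma^j(x)\in E$. The algorithms may depend on $X$; each of them is uniform in its input. -/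

import Mathlib

namespace ZSubshift

/-- The `n`-th power `σ ^ n` of the shift map `σ (x) i = x (i + 1)`. -/
def shift (n : ℤ) (x : ℤ → ℕ) : ℤ → ℕ := fun i => x (i + n)

/-- A subshift: a compact subset `X` of `ℕ ^ ℤ` (`ℕ` discrete, product topology) with `σ (X) = X`.
By compactness only finitely many letters occur in `X`. -/
def IsSubshift (X : Set (ℤ → ℕ)) : Prop :=
  IsCompact X ∧ shift 1 '' X = X

/-- A subshift is quasiminimal if it has finitely many proper subshifts. -/
def IsQuasiminimal (X : Set (ℤ → ℕ)) : Prop :=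
  {Y : Set (ℤ → ℕ) | IsSubshift Y ∧ Y ⊂ X}.Finite

/-- The cylinder `[w]_i` of points that carry the word `w` at the coordinates
`i, …, i + |w| - 1`. -/
def cylinder (i : ℤ) (w : List ℕ) : Set (ℤ → ℕ) :=
  {x | ∀ (k : ℕ) (hk : k < w.length), x (i + (k : ℤ)) = w[k]}

/-- The language of `X`: all words that occur in some point of `X`. -/
def language (X : Set (ℤ → ℕ)) : Language ℕ :=
  {w | ∃ x ∈ X, ∃ i : ℤ, x ∈ cylinder i w}

/-- A `Π⁰₁` subshift is one whose language is `Π⁰₁`: the complement of the language is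
recursively enumerable. -/
def IsPi01 (X : Set (ℤ → ℕ)) : Prop :=
  REPred fun w : List ℕ => w ∉ language X

/-- A finite description of a clopen set: a coordinate and a finite list of words. -/
abbrev ClopenCode : Type := ℤ × List (List ℕ)

/-- The clopen set `[C]_i = [w₁]_i ∪ ⋯ ∪ [w_k]_i` described by `(i, [w₁, …, w_k])`. -/
def clopenSet (C : ClopenCode) : Set (ℤ → ℕ) :=
  {x | ∃ w ∈ C.2, x ∈ cylinder C.1 w}

/-- The `a`-th clopen set of a list (letters are numbered from `0`; empty if there is none). -/
def cell (P : List ClopenCode) (a : ℕ) : Set (ℤ → ℕ) :=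
  {x | ∃ C ∈ P[a]?, x ∈ clopenSet C}

/-- The clopen sets listed in `P` cut `X` into pairwise disjoint parts that cover `X`. -/
def IsClopenPartition (X : Set (ℤ → ℕ)) (P : List ClopenCode) : Prop :=
  ∀ x ∈ X, ∃! a : ℕ, a < P.length ∧ x ∈ cell P a

/-- The model-checking problem of `X` for a class of languages is decidable. The class is presented
by codes in `ι`: for a code `c` with `Valid m c`, `lang m c` is a language over the
`m`-letter alphabet `{0, …, m - 1}`. An instance is a clopen partition of `X` into `m` sets
together with the code of a language `L` over `m` letters, and the question is whether there are
`w ∈ L` and `x ∈ X` such that `σ ^ i (x)` is in the set numbered `w_i` for all `i < |w|`. -/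
def ModelCheckingDecidable (X : Set (ℤ → ℕ)) {ι : Type} [Primcodable ι]
    (Valid : ℕ → ι → Prop) (lang : ℕ → ι → Language ℕ) : Prop :=
  ∃ f : List ClopenCode × ι → Bool, Computable f ∧
    ∀ (P : List ClopenCode) (c : ι), IsClopenPartition X P → Valid P.length c →
      (f (P, c) = true ↔
        ∃ w ∈ lang P.length c, ∃ x ∈ X,
          ∀ (i : ℕ) (hi : i < w.length), shift (i : ℤ) x ∈ cell P w[i])

/-- The set `S^*` of all words over the alphabet `S = {0, …, m - 1}`. -/
def allWords (m : ℕ) : Language ℕ := {w | ∀ a ∈ w, a < m}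

/-- The elementary piecewise testable language `a₁ S^* a₂ S^* ⋯ S^* a_k` over
`S = {0, …, m - 1}`, given by the list `[a₁, …, a_k]`. -/
def elementaryPT (m : ℕ) : List ℕ → Language ℕ
  | [] => 1
  | [a] => {[a]}
  | a :: b :: l => {[a]} * allWords m * elementaryPT m (b :: l)

/-- The lists `[a₁, …, a_k]` with `k ≥ 1` and letters in `{0, …, m - 1}`. -/
def IsEPTCode (m : ℕ) (l : List ℕ) : Prop :=
  l ≠ [] ∧ ∀ a ∈ l, a < m

/-- Some point of `X` visits the clopen sets listed in `T` in order, that is, at times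
`i₁ < i₂ < ⋯ < i_k`. -/
def VisitsInOrder (X : Set (ℤ → ℕ)) (T : List ClopenCode) : Prop :=
  ∃ x ∈ X, ∃ i : Fin T.length → ℤ, StrictMono i ∧ ∀ j, shift (i j) x ∈ clopenSet T[j]

/-- The question of the halting problem of `X` for two given clopen sets: does some point of `X`
that lies in the first one reach the second one after `j ≥ 0` steps? -/
def Halts (X : Set (ℤ → ℕ)) (C D : ClopenCode) : Prop :=
  ∃ x ∈ X, ∃ j : ℕ, x ∈ clopenSet C ∧ shift (j : ℤ) x ∈ clopenSet D

end ZSubshift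

/-! All three problems reduce to problem (2), visiting clopen sets in order.

Since `X` has finitely many subshifts, finitely many words separate any subshift `Y` of `X` from the
others. Hence `Y` is cut out of `X` by a finite list of forbidden words (`exists_eq_avoid`), and
compactness makes the complement of its language r.e. (`notMem_language_avoid_iff`). The language
itself is r.e. too: `w` occurs in `Y` iff forbidding `w` as well makes one of finitely many test
words disappear (`computablePred_mem_language`).

Sort the points of `X` by their orbit closure `Y`; there are finitely many classes, and each may
have its own algorithm. If every point with closure `Y` is recurrent in the past or in the future,
then it visits every clopen set that meets `Y` infinitely often in that direction, so the order is
irrelevant and the language of `Y` decides.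

Otherwise some `x` with closure `Y` is recurrent in neither direction. Then `x` is isolated in its
orbit closure, it is up to a shift the only point with that closure, and it is computable, because
an isolating word fixes coordinates. Successful visits are found by search. Failure has finite
certificates: sets visited infinitely often in the past can be served arbitrarily early, a greedy
run starts before all visits to the first remaining set, and some set still pending at the end of
the run is provably never visited again (`computablePred_visits_of_bounds`). The bounds come from
the forbidden words of the two limit sets of `x`. -/

open Encodable

/-! ### Closure properties of r.e. and decidable predicates -/

section REPredClosure

variable {α β γ : Type*} [Primcodable α] [Primcodable β] [Primcodable γ]

/-- The stages are step-bounded runs of a program; their monotonicity lets finitely many conditions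
share one bound. -/
theorem REPred.exists_primrec_stages {p : α → Prop} (hp : REPred p) :
    ∃ q : α → ℕ → Bool, Primrec₂ q ∧ (∀ a m n, m ≤ n → q a m = true → q a n = true) ∧
      ∀ a, p a ↔ ∃ n, q a n = true := by
  obtain ⟨c, hc⟩ := Nat.Partrec.Code.exists_code.1 hp
  refine ⟨fun a k => (Nat.Partrec.Code.evaln k c (encode a)).isSome, ?_, ?_, ?_⟩
  · exact Primrec.option_isSome.comp (Nat.Partrec.Code.primrec_evaln.comp
      ((Primrec.snd.pair (Primrec.const c)).pair (Primrec.encode.comp Primrec.fst)))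
  · intro a m n hmn h
    obtain ⟨x, hx⟩ := Option.isSome_iff_exists.1 h
    exact Option.isSome_iff_exists.2 ⟨x, Nat.Partrec.Code.evaln_mono hmn hx⟩
  · intro a
    have h1 : (Nat.Partrec.Code.eval c (encode a)).Dom ↔ p a := by
      rw [hc]
      simp [Part.assert]
    rw [← h1, Part.dom_iff_mem]
    simp only [Nat.Partrec.Code.evaln_complete, Option.isSome_iff_exists, Option.mem_def]
    exact exists_comm

theorem Computable₂.exists_re {q : α → ℕ → Bool} (hq : Computable₂ q) :
    REPred fun a => ∃ n, q a n = true :=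
  (Partrec.rfind hq.partrec₂).dom_re.of_eq fun a => by
    rw [Nat.rfind_dom']
    simp

theorem REPred.comp {p : β → Prop} (hp : REPred p) {f : α → β} (hf : Computable f) :
    REPred fun a => p (f a) :=
  Partrec.comp hp hf

theorem ComputablePred.comp {p : β → Prop} (hp : ComputablePred p) {f : α → β}
    (hf : Computable f) : ComputablePred fun a => p (f a) := by
  obtain ⟨_, h⟩ := hp
  exact ⟨inferInstance, h.comp hf⟩

theorem ComputablePred.const (p : Prop) : ComputablePred fun _ : α => p := by
  classical
  exact ⟨fun _ => inferInstance, Computable.const (decide p)⟩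

theorem ComputablePred.eq [DecidableEq β] {f g : α → β} (hf : Computable f) (hg : Computable g) :
    ComputablePred fun a => f a = g a :=
  ComputablePred.comp (p := fun x : β × β => x.1 = x.2) (Primrec.eq (α := β)).computablePred
    (hf.pair hg)

theorem REPred.exists {p : α → β → Prop} (hp : REPred fun x : α × β => p x.1 x.2) :
    REPred fun a => ∃ b, p a b := by
  obtain ⟨q, hq, -, h⟩ := hp.exists_primrec_stages
  -- Dovetailing: `m` pairs the code of a candidate witness with a number of steps; codes of nothing
  -- count as failure.
  have : Computable₂ fun (a : α) (m : ℕ) =>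
      ((decode (α := β) m.unpair.1).map fun b => q (a, b) m.unpair.2).getD false := by
    refine Computable.option_getD (Computable.option_map ?_ ?_) (Computable.const false)
    · exact Computable.decode.comp (Computable.fst.comp (Computable.unpair.comp Computable.snd))
    · exact hq.to_comp.comp
        ((Computable.fst.comp Computable.fst).pair Computable.snd)
        (Computable.snd.comp (Computable.unpair.comp (Computable.snd.comp Computable.fst)))
  refine this.exists_re.of_eq fun a => ?_
  constructor
  · rintro ⟨m, hm⟩
    rcases hd : decode (α := β) m.unpair.1 with _ | b
    · simp [hd] at hm
    · exact ⟨b, (h (a, b)).2 ⟨_, by simpa [hd] using hm⟩⟩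
  · rintro ⟨b, hb⟩
    obtain ⟨n, hn⟩ := (h (a, b)).1 hb
    exact ⟨Nat.pair (encode b) n, by simpa using hn⟩

theorem REPred.and {p q : α → Prop} (hp : REPred p) (hq : REPred q) :
    REPred fun a => p a ∧ q a := by
  obtain ⟨f, hf, mf, ef⟩ := hp.exists_primrec_stages
  obtain ⟨g, hg, mg, eg⟩ := hq.exists_primrec_stages
  have : Computable₂ fun a n => f a n && g a n := (Primrec.and.comp₂ hf hg).to_comp
  refine this.exists_re.of_eq fun a => ?_
  simp only [Bool.and_eq_true, ef, eg]
  constructor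
  · rintro ⟨n, h1, h2⟩
    exact ⟨⟨n, h1⟩, n, h2⟩
  · rintro ⟨⟨m, h1⟩, n, h2⟩
    exact ⟨max m n, mf _ _ _ (le_max_left _ _) h1, mg _ _ _ (le_max_right _ _) h2⟩

theorem REPred.or {p q : α → Prop} (hp : REPred p) (hq : REPred q) :
    REPred fun a => p a ∨ q a := by
  obtain ⟨f, hf, -, ef⟩ := hp.exists_primrec_stages
  obtain ⟨g, hg, -, eg⟩ := hq.exists_primrec_stages
  have : Computable₂ fun a n => f a n || g a n := (Primrec.or.comp₂ hf hg).to_comp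
  refine this.exists_re.of_eq fun a => ?_
  simp only [Bool.or_eq_true, ef, eg, exists_or]

theorem REPred.exists_mem {p : α → β → Prop} (hp : REPred fun x : α × β => p x.1 x.2)
    {l : α → List β} (hl : Computable l) : REPred fun a => ∃ b ∈ l a, p a b := by
  classical
  have h1 : REPred fun x : α × β => x.2 ∈ l x.1 := by
    have : PrimrecRel fun (L : List β) (b : β) => ∃ c ∈ L, c = b :=
      PrimrecRel.exists_mem_list Primrec.eq
    have h2 : ComputablePred fun x : List β × β => ∃ c ∈ x.1, c = x.2 :=
      PrimrecPred.computablePred this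
    exact (h2.comp ((hl.comp Computable.fst).pair Computable.snd)).to_re.of_eq (by simp)
  exact (h1.and hp).exists

theorem REPred.forall_mem {p : α → β → Prop} (hp : REPred fun x : α × β => p x.1 x.2)
    {l : α → List β} (hl : Computable l) : REPred fun a => ∀ b ∈ l a, p a b := by
  obtain ⟨q, hq, mq, h⟩ := hp.exists_primrec_stages
  have h1 : PrimrecRel fun (b : β) (x : α × ℕ) => q (x.1, b) x.2 = true := by
    refine ⟨inferInstance, ?_⟩
    refine Primrec.of_eq (f := fun y : β × α × ℕ => q (y.2.1, y.1) y.2.2) ?_ (by simp)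
    exact hq.comp ((Primrec.fst.comp Primrec.snd).pair Primrec.fst) (Primrec.snd.comp Primrec.snd)
  have h2 : ComputablePred fun y : List β × α × ℕ => ∀ b ∈ y.1, q (y.2.1, b) y.2.2 = true :=
    PrimrecPred.computablePred h1.forall_mem_list
  have h3 : ComputablePred fun y : α × ℕ => ∀ b ∈ l y.1, q (y.1, b) y.2 = true :=
    h2.comp ((hl.comp Computable.fst).pair Computable.id)
  refine (REPred.exists (p := fun a n => ∀ b ∈ l a, q (a, b) n = true) h3.to_re).of_eq fun a => ?_
  simp only [fun b => h (a, b)]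
  generalize l a = L
  constructor
  · rintro ⟨n, hn⟩ b hb
    exact ⟨n, hn b hb⟩
  · intro H
    choose! n hn using H
    -- The sum dominates each of the finitely many stages.
    refine ⟨(L.map n).sum, fun b hb => mq _ _ _ ?_ (hn b hb)⟩
    exact List.le_sum_of_mem (List.mem_map_of_mem hb)

theorem ComputablePred.of_re {p q : α → Prop} (hp : REPred p) (hq : REPred q)
    (h : ∀ a, q a ↔ ¬ p a) : ComputablePred p :=
  ComputablePred.computable_iff_re_compl_re'.2 ⟨hp, hq.of_eq h⟩

theorem ComputablePred.not_re {p : α → Prop} (hp : ComputablePred p) : REPred fun a => ¬ p a :=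
  (ComputablePred.computable_iff_re_compl_re'.1 hp).2

theorem ComputablePred.or {p q : α → Prop} (hp : ComputablePred p) (hq : ComputablePred q) :
    ComputablePred fun a => p a ∨ q a :=
  ComputablePred.of_re (hp.to_re.or hq.to_re) (hp.not_re.and hq.not_re) fun _ => not_or.symm

theorem ComputablePred.exists_mem {p : α → β → Prop}
    (hp : ComputablePred fun x : α × β => p x.1 x.2) {l : α → List β} (hl : Computable l) :
    ComputablePred fun a => ∃ b ∈ l a, p a b :=
  ComputablePred.of_re (hp.to_re.exists_mem hl)
    (REPred.forall_mem (p := fun a b => ¬ p a b) hp.not_re hl) fun a => by simp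

theorem ComputablePred.forall_mem {p : α → β → Prop}
    (hp : ComputablePred fun x : α × β => p x.1 x.2) {l : α → List β} (hl : Computable l) :
    ComputablePred fun a => ∀ b ∈ l a, p a b :=
  ComputablePred.of_re (hp.to_re.forall_mem hl)
    (REPred.exists_mem (p := fun a b => ¬ p a b) hp.not_re hl) fun a => by simp

/-- No uniformity in `i` is required; this is what allows a separate algorithm for each orbit
closure. -/
theorem ComputablePred.exists_mem_finite {ι : Type*} {p : ι → α → Prop} {s : Set ι}
    (hs : s.Finite) (h : ∀ i ∈ s, ComputablePred (p i)) :
    ComputablePred fun a => ∃ i ∈ s, p i a := by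
  induction s, hs using Set.Finite.induction_on with
  | empty => exact (ComputablePred.const False).of_eq (by simp)
  | insert _ _ ih =>
    refine ((h _ (Set.mem_insert _ _)).or
      (ih fun i hi => h i (Set.mem_insert_of_mem _ hi))).of_eq fun a => ?_
    simp

end REPredClosure

/-! ### Computability of integer addition -/

section IntComputable

theorem Int.encode_ofNat (n : ℕ) : encode (Int.ofNat n) = 2 * n := rfl

theorem Int.encode_negSucc (n : ℕ) : encode (Int.negSucc n) = 2 * n + 1 := rfl

theorem Computable.int_natCast : Computable fun n : ℕ => (n : ℤ) := by
  refine Computable.encode_iff.1 ?_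
  exact (Primrec.nat_mul.comp (Primrec.const 2) Primrec.id).to_comp.of_eq fun n => rfl

theorem Computable.int_toNat : Computable Int.toNat := by
  have : Primrec fun z : ℤ => if encode z % 2 = 0 then encode z / 2 else 0 :=
    Primrec.ite (Primrec.eq.comp (Primrec.nat_mod.comp Primrec.encode (Primrec.const 2))
      (Primrec.const 0)) (Primrec.nat_div.comp Primrec.encode (Primrec.const 2)) (Primrec.const 0)
  refine this.to_comp.of_eq fun z => ?_
  rcases z with n | n
  · rw [Int.encode_ofNat]
    simp
  · rw [Int.encode_negSucc, if_neg (by omega)]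
    rfl

theorem Computable.int_neg_toNat : Computable fun z : ℤ => (-z).toNat := by
  have : Primrec fun z : ℤ => if encode z % 2 = 0 then 0 else encode z / 2 + 1 :=
    Primrec.ite (Primrec.eq.comp (Primrec.nat_mod.comp Primrec.encode (Primrec.const 2))
      (Primrec.const 0)) (Primrec.const 0)
      (Primrec.succ.comp (Primrec.nat_div.comp Primrec.encode (Primrec.const 2)))
  refine this.to_comp.of_eq fun z => ?_
  rcases z with n | n
  · rw [Int.encode_ofNat]
    simp
  · rw [Int.encode_negSucc, if_neg (by omega), Int.neg_negSucc, Int.toNat_natCast]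
    omega

theorem Computable.int_subNatNat : Computable₂ Int.subNatNat := by
  refine Computable.encode_iff.1 ?_
  have : Primrec fun x : ℕ × ℕ =>
      if x.2 ≤ x.1 then 2 * (x.1 - x.2) else 2 * (x.2 - x.1 - 1) + 1 :=
    Primrec.ite (Primrec.nat_le.comp Primrec.snd Primrec.fst)
      (Primrec.nat_mul.comp (Primrec.const 2) (Primrec.nat_sub.comp Primrec.fst Primrec.snd))
      (Primrec.succ.comp (Primrec.nat_mul.comp (Primrec.const 2)
        (Primrec.nat_sub.comp (Primrec.nat_sub.comp Primrec.snd Primrec.fst) (Primrec.const 1))))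
  refine this.to_comp.of_eq fun ⟨a, b⟩ => ?_
  dsimp only
  split_ifs with h
  · rw [Int.subNatNat_of_le h, ← Int.encode_ofNat]
    rfl
  · rw [Int.subNatNat_of_lt (by omega), ← Int.encode_negSucc]
    rfl

/-- Positive and negative parts are added as natural numbers and then subtracted. -/
theorem Computable.int_add : Computable₂ fun a b : ℤ => a + b := by
  have hadd : Computable₂ fun a b : ℕ => a + b := Primrec.nat_add.to_comp
  refine (Computable.int_subNatNat.comp
    (hadd.comp (Computable.int_toNat.comp Computable.fst) (Computable.int_toNat.comp Computable.snd))
    (hadd.comp (Computable.int_neg_toNat.comp Computable.fst)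
      (Computable.int_neg_toNat.comp Computable.snd))).of_eq fun ⟨a, b⟩ => ?_
  rw [Int.subNatNat_eq_coe]
  push_cast
  omega

end IntComputable

/-! ### Composition rules for `fun_prop` -/

section ComputableComposition

attribute [fun_prop] Computable

attribute [fun_prop] Computable.const Computable.comp Computable.pair

variable {α β γ : Type*} [Primcodable α] [Primcodable β] [Primcodable γ]

@[fun_prop]
theorem Computable.id' : Computable fun a : α => a := Computable.id

@[fun_prop]
theorem Computable.fst_comp {f : α → β × γ} (hf : Computable f) : Computable fun a => (f a).1 :=
  Computable.fst.comp hf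

@[fun_prop]
theorem Computable.snd_comp {f : α → β × γ} (hf : Computable f) : Computable fun a => (f a).2 :=
  Computable.snd.comp hf

@[fun_prop]
theorem Computable.append_comp {f g : α → List β} (hf : Computable f) (hg : Computable g) :
    Computable fun a => f a ++ g a :=
  Computable.list_append.comp hf hg

@[fun_prop]
theorem Computable.cons_comp {f : α → β} {g : α → List β} (hf : Computable f)
    (hg : Computable g) : Computable fun a => f a :: g a :=
  Computable.list_cons.comp hf hg

@[fun_prop]
theorem Computable.length_comp {f : α → List β} (hf : Computable f) :
    Computable fun a => (f a).length :=
  Computable.list_length.comp hf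

@[fun_prop]
theorem Computable.int_natCast_comp {f : α → ℕ} (hf : Computable f) :
    Computable fun a => (f a : ℤ) :=
  Computable.int_natCast.comp hf

@[fun_prop]
theorem Computable.int_add_comp {f g : α → ℤ} (hf : Computable f) (hg : Computable g) :
    Computable fun a => f a + g a :=
  Computable.int_add.comp hf hg

end ComputableComposition

open Filter Topology

namespace ZSubshift

/-! ### Cylinders and windows -/

section Cylinders

theorem shift_shift (m n : ℤ) (x : ℤ → ℕ) : shift m (shift n x) = shift (m + n) x := by
  funext i
  simp only [shift]
  congr 1
  ring

theorem shift_zero (x : ℤ → ℕ) : shift 0 x = x := by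
  funext i
  simp [shift]

theorem continuous_shift (n : ℤ) : Continuous (shift n) :=
  continuous_pi fun i => continuous_apply (i + n)

theorem shift_mem_cylinder {t p : ℤ} {w : List ℕ} {x : ℤ → ℕ} :
    shift t x ∈ cylinder p w ↔ x ∈ cylinder (p + t) w := by
  simp only [cylinder, shift, Set.mem_ofPred_eq, add_right_comm]

theorem isClopen_cylinder (p : ℤ) (w : List ℕ) : IsClopen (cylinder p w) := by
  have : cylinder p w = ⋂ k : Fin w.length, (fun x : ℤ → ℕ => x (p + (k : ℕ))) ⁻¹' {w[k]} := by
    ext x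
    simp only [cylinder, Set.mem_ofPred_eq, Set.mem_iInter, Set.mem_preimage, Set.mem_singleton_iff]
    exact ⟨fun h k => h k k.2, fun h k hk => h ⟨k, hk⟩⟩
  rw [this]
  exact isClopen_iInter_of_finite fun k =>
    (isClopen_discrete _).preimage (continuous_apply _)

theorem isClopen_clopenSet (D : ClopenCode) : IsClopen (clopenSet D) := by
  have : clopenSet D = ⋃ w ∈ {w | w ∈ D.2}, cylinder D.1 w := by
    ext x
    simp [clopenSet]
  rw [this]
  exact (List.finite_toSet D.2).isClopen_biUnion fun w _ => isClopen_cylinder _ _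

theorem shift_mem_clopenSet {t : ℤ} {D : ClopenCode} {x : ℤ → ℕ} :
    shift t x ∈ clopenSet D ↔ ∃ w ∈ D.2, x ∈ cylinder (D.1 + t) w := by
  simp only [clopenSet, Set.mem_ofPred_eq, shift_mem_cylinder]

/-- The word of length `n` that `x` carries from the coordinate `p` on. -/
def window (x : ℤ → ℕ) (p : ℤ) (n : ℕ) : List ℕ := (List.range n).map fun k : ℕ => x (p + (k : ℤ))

@[simp] theorem length_window (x : ℤ → ℕ) (p : ℤ) (n : ℕ) : (window x p n).length = n := by
  simp [window]

theorem mem_cylinder_window {x y : ℤ → ℕ} {p : ℤ} {n : ℕ} :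
    y ∈ cylinder p (window x p n) ↔ ∀ k < n, y (p + (k : ℤ)) = x (p + (k : ℤ)) := by
  simp [cylinder, window]

theorem self_mem_cylinder_window (x : ℤ → ℕ) (p : ℤ) (n : ℕ) : x ∈ cylinder p (window x p n) :=
  mem_cylinder_window.2 fun _ _ => rfl

theorem mem_cylinder_iff_eq_window {x : ℤ → ℕ} {p : ℤ} {w : List ℕ} :
    x ∈ cylinder p w ↔ w = window x p w.length := by
  constructor
  · intro h
    refine List.ext_getElem (by simp) fun k hk _ => ?_
    simp [window, h k hk]
  · intro h
    rw [h]
    exact self_mem_cylinder_window _ _ _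

theorem mem_cylinder_append {x : ℤ → ℕ} {p : ℤ} {v w : List ℕ} :
    x ∈ cylinder p (v ++ w) ↔ x ∈ cylinder p v ∧ x ∈ cylinder (p + v.length) w := by
  constructor
  · intro h
    refine ⟨fun k hk => ?_, fun k hk => ?_⟩
    · rw [h k (by simp; omega), List.getElem_append_left hk]
    · have := h (v.length + k) (by simp; omega)
      rw [List.getElem_append_right (by omega)] at this
      simpa [add_assoc] using this
  · rintro ⟨h1, h2⟩ k hk
    by_cases hv : k < v.length
    · rw [List.getElem_append_left hv, h1 k hv]
    · rw [List.getElem_append_right (by omega), ← h2 (k - v.length) (by simp at hk; omega)]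
      congr 1
      omega

theorem exists_cylinder_subset {U : Set (ℤ → ℕ)} (hU : IsOpen U) {x : ℤ → ℕ} (hx : x ∈ U) :
    ∃ n : ℕ, cylinder (-n) (window x (-n) (2 * n + 1)) ⊆ U := by
  obtain ⟨I, u, hu, hI⟩ := isOpen_pi_iff.1 hU x hx
  refine ⟨I.sup Int.natAbs, fun y hy => hI fun i hi => ?_⟩
  have hle : i.natAbs ≤ I.sup Int.natAbs := Finset.le_sup (f := Int.natAbs) hi
  have := mem_cylinder_window.1 hy (i + (I.sup Int.natAbs : ℕ)).toNat (by omega)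
  have h2 : -((I.sup Int.natAbs : ℕ) : ℤ) + ((i + (I.sup Int.natAbs : ℕ)).toNat : ℤ) = i := by
    omega
  rw [h2] at this
  rw [this]
  exact (hu i hi).2

end Cylinders

/-! ### Subshifts, their languages and forbidden words -/

section Subshifts

variable {X Y Z : Set (ℤ → ℕ)}

theorem IsSubshift.shift_mem (hX : IsSubshift X) {x : ℤ → ℕ} (hx : x ∈ X) (n : ℤ) :
    shift n x ∈ X := by
  have h1 : ∀ y ∈ X, shift 1 y ∈ X := fun y hy => hX.2 ▸ Set.mem_image_of_mem _ hy
  have h2 : ∀ y ∈ X, shift (-1) y ∈ X := by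
    intro y hy
    rw [← hX.2] at hy
    obtain ⟨z, hz, rfl⟩ := hy
    rwa [shift_shift, neg_add_cancel, shift_zero]
  induction n with
  | zero => rwa [shift_zero]
  | succ n ih => rw [add_comm, ← shift_shift]; exact h1 _ ih
  | pred n ih => rw [sub_eq_add_neg, add_comm, ← shift_shift]; exact h2 _ ih

theorem IsSubshift.of_isClosed (hX : IsSubshift X) (hYX : Y ⊆ X) (hY : IsClosed Y)
    (h : ∀ x ∈ Y, ∀ n, shift n x ∈ Y) : IsSubshift Y := by
  refine ⟨hX.1.of_isClosed_subset hY hYX, Set.Subset.antisymm ?_ ?_⟩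
  · rintro _ ⟨x, hx, rfl⟩
    exact h x hx 1
  · intro x hx
    exact ⟨shift (-1) x, h x hx _, by rw [shift_shift, add_neg_cancel, shift_zero]⟩

theorem language_mono (h : Y ⊆ Z) : language Y ≤ language Z := by
  rintro w ⟨x, hx, i, hi⟩
  exact ⟨x, h hx, i, hi⟩

/-- Every central window of a point of `Y` occurs in `Z`; shifting it into place approximates the
point from the closed set `Z`. -/
theorem IsSubshift.subset_of_language_le (hZ : IsSubshift Z) (h : language Y ≤ language Z) :
    Y ⊆ Z := by
  intro x hx
  rw [← hZ.1.isClosed.closure_eq, mem_closure_iff]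
  intro U hU hxU
  obtain ⟨n, hn⟩ := exists_cylinder_subset hU hxU
  obtain ⟨z, hz, i, hi⟩ := h ⟨x, hx, _, self_mem_cylinder_window x (-n) (2 * n + 1)⟩
  refine ⟨shift (i + n) z, hn ?_, hZ.shift_mem hz _⟩
  rw [shift_mem_cylinder, show -(n : ℤ) + (i + n) = i by ring]
  exact hi

theorem IsSubshift.exists_mem_language_notMem (hZ : IsSubshift Z) (h : ¬ Y ⊆ Z) :
    ∃ w ∈ language Y, w ∉ language Z := by
  by_contra! H
  exact h (hZ.subset_of_language_le H)

theorem IsSubshift.exists_letter_bound (hX : IsSubshift X) :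
    ∃ s : ℕ, ∀ x ∈ X, ∀ i, x i < s := by
  obtain ⟨s, hs⟩ := (hX.1.image (continuous_apply (0 : ℤ))).bddAbove
  refine ⟨s + 1, fun x hx i => Nat.lt_succ_of_le (hs ⟨shift i x, hX.shift_mem hx i, ?_⟩)⟩
  simp [shift]

/-- The points of `X` in which no word of `F` occurs. -/
def avoid (X : Set (ℤ → ℕ)) (F : List (List ℕ)) : Set (ℤ → ℕ) :=
  {x ∈ X | ∀ w ∈ F, ∀ p : ℤ, x ∉ cylinder p w}

theorem IsSubshift.avoid (hX : IsSubshift X) (F : List (List ℕ)) : IsSubshift (avoid X F) := by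
  refine hX.of_isClosed (fun x hx => hx.1) ?_ fun x hx n => ⟨hX.shift_mem hx.1 n, fun w hw p => ?_⟩
  · have : ZSubshift.avoid X F = X ∩ ⋂ w ∈ F, ⋂ p : ℤ, (cylinder p w)ᶜ := by
      ext x
      simp [ZSubshift.avoid]
    rw [this]
    exact hX.1.isClosed.inter (isClosed_iInter fun w => isClosed_iInter fun _ =>
      isClosed_iInter fun p => (isClopen_cylinder p w).compl.isClosed)
  · rw [shift_mem_cylinder]
    exact hx.2 w hw _

theorem notMem_language_avoid {F : List (List ℕ)} {w : List ℕ} (hw : w ∈ F) :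
    w ∉ language (avoid X F) := by
  rintro ⟨x, hx, p, hp⟩
  exact hx.2 w hw p hp

theorem subset_avoid {F : List (List ℕ)} (hYX : Y ⊆ X) (h : ∀ w ∈ F, w ∉ language Y) :
    Y ⊆ avoid X F :=
  fun x hx => ⟨hYX hx, fun w hw p hp => h w hw ⟨x, hx, p, hp⟩⟩

theorem IsQuasiminimal.finite_subshifts (hq : IsQuasiminimal X) :
    {Y | IsSubshift Y ∧ Y ⊆ X}.Finite := by
  refine (Set.Finite.insert X hq).subset fun Y hY => ?_
  rcases hY.2.eq_or_ssubset with h | h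
  · exact Or.inl h
  · exact Or.inr ⟨hY.1, h⟩

/-- For each of the finitely many subshifts `Z` of `X` not inside `Y`, forbid one word that occurs
in `Z` but not in `Y`. -/
theorem exists_eq_avoid (hX : IsSubshift X) (hq : IsQuasiminimal X) (hY : IsSubshift Y)
    (hYX : Y ⊆ X) : ∃ F : List (List ℕ), Y = avoid X F := by
  have : ∀ Z : Set (ℤ → ℕ), ∃ w, ¬ Z ⊆ Y → w ∈ language Z ∧ w ∉ language Y := by
    intro Z
    by_cases h : Z ⊆ Y
    · exact ⟨[], fun h' => (h' h).elim⟩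
    · obtain ⟨w, h1, h2⟩ := hY.exists_mem_language_notMem h
      exact ⟨w, fun _ => ⟨h1, h2⟩⟩
  choose f hf using this
  have hfin : {Z | (IsSubshift Z ∧ Z ⊆ X) ∧ ¬ Z ⊆ Y}.Finite :=
    hq.finite_subshifts.subset fun Z hZ => hZ.1
  refine ⟨hfin.toFinset.toList.map f, Set.Subset.antisymm (subset_avoid hYX ?_) ?_⟩
  · intro w hw
    simp only [List.mem_map, Finset.mem_toList, Set.Finite.mem_toFinset] at hw
    obtain ⟨Z, hZ, rfl⟩ := hw
    exact (hf Z hZ.2).2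
  -- `avoid X F` would itself be one of these `Z`, so it would contain its own forbidden word.
  · by_contra h
    refine notMem_language_avoid ?_ (hf _ h).1
    simp only [List.mem_map, Finset.mem_toList, Set.Finite.mem_toFinset]
    exact ⟨_, ⟨⟨hX.avoid _, fun x hx => hx.1⟩, h⟩, rfl⟩

/-- Every extension of `w` by `R` letters `< s` on both sides is either not in the language of `X`
or contains a word of `F`. -/
def Excludes (X : Set (ℤ → ℕ)) (s : ℕ) (F : List (List ℕ)) (w : List ℕ) (R : ℕ) : Prop :=
  ∀ a : List ℕ, a.length = R → (∀ c ∈ a, c < s) → ∀ b : List ℕ, b.length = R → (∀ c ∈ b, c < s) →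
    a ++ w ++ b ∉ language X ∨ ∃ u ∈ F, ∃ v z : List ℕ, v ++ u ++ z = a ++ w ++ b

theorem window_add (x : ℤ → ℕ) (p : ℤ) (m n : ℕ) :
    window x p (m + n) = window x p m ++ window x (p + m) n := by
  symm
  have : x ∈ cylinder p (window x p m ++ window x (p + m) n) :=
    mem_cylinder_append.2 ⟨self_mem_cylinder_window _ _ _, by
      rw [length_window]; exact self_mem_cylinder_window _ _ _⟩
  simpa using mem_cylinder_iff_eq_window.1 this

/-- The window with margins `R` around an occurrence of `w` in `x` lies in the language, so only the
second alternative remains. The location of `u` is recorded for the later bounds on visit times. -/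
theorem Excludes.exists_occurrence {s R : ℕ} {F : List (List ℕ)} {w : List ℕ}
    (h : Excludes X s F w R) (hs : ∀ x ∈ X, ∀ i, x i < s) {x : ℤ → ℕ} (hx : x ∈ X) {p : ℤ}
    (hp : x ∈ cylinder p w) :
    ∃ u ∈ F, ∃ q, p - R ≤ q ∧ q + u.length ≤ p + w.length + R ∧ x ∈ cylinder q u := by
  have hwin : ∀ p n, ∀ c ∈ window x p n, c < s := by
    intro p n c hc
    simp only [window, List.mem_map] at hc
    obtain ⟨k, -, rfl⟩ := hc
    exact hs x hx _
  have hmem : x ∈ cylinder (p - R) (window x (p - R) R ++ w ++ window x (p + w.length) R) := by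
    rw [mem_cylinder_append, mem_cylinder_append]
    refine ⟨⟨self_mem_cylinder_window _ _ _, by simpa using hp⟩, ?_⟩
    have e : p - R + ((window x (p - R) R ++ w).length : ℕ) = p + w.length := by
      simp only [List.length_append, length_window]
      omega
    rw [e]
    exact self_mem_cylinder_window _ _ _
  rcases h (window x (p - R) R) (length_window _ _ _) (hwin _ _) (window x (p + w.length) R)
    (length_window _ _ _) (hwin _ _) with h | ⟨u, hu, v, z, hvz⟩
  · exact (h ⟨x, hx, _, hmem⟩).elim
  · have hlen := congrArg List.length hvz
    simp only [List.length_append, length_window] at hlen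
    refine ⟨u, hu, p - R + v.length, by omega, by omega, ?_⟩
    rw [← hvz, mem_cylinder_append, mem_cylinder_append] at hmem
    exact hmem.1.2

/-- Compactness: if every margin `R` fails, the nested sets `K R` of points carrying `w` at `0` with
no word of `F` within distance `R` have a common point, and it avoids `F`. -/
theorem notMem_language_avoid_iff (hX : IsSubshift X) {s : ℕ} (hs : ∀ x ∈ X, ∀ i, x i < s)
    {F : List (List ℕ)} {w : List ℕ} :
    w ∉ language (avoid X F) ↔ ∃ R, Excludes X s F w R := by
  constructor
  · intro hw
    by_contra! H
    let K : ℕ → Set (ℤ → ℕ) := fun R => X ∩ (cylinder 0 w ∩ ⋂ u ∈ F, ⋂ p : ℤ,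
      ⋂ (_ : -(R : ℤ) ≤ p ∧ p + u.length ≤ w.length + R), (cylinder p u)ᶜ)
    have hKc : ∀ R, IsClosed (K R) := fun R => hX.1.isClosed.inter
      ((isClopen_cylinder 0 w).isClosed.inter (isClosed_iInter fun u => isClosed_iInter fun _ =>
        isClosed_iInter fun p => isClosed_iInter fun _ => (isClopen_cylinder p u).compl.isClosed))
    have hKn : ∀ R, (K R).Nonempty := by
      intro R
      have := H R
      simp only [Excludes, not_forall, not_or, not_exists, not_not, not_and] at this
      obtain ⟨a, ha, -, b, hb, -, ⟨x, hx, i, hi⟩, hF⟩ := this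
      have hxs : ∀ p v, shift (i + R) x ∈ cylinder p v ↔ x ∈ cylinder (p + (i + R)) v :=
        fun p v => shift_mem_cylinder
      refine ⟨shift (i + R) x, hX.shift_mem hx _, ?_, ?_⟩
      · rw [mem_cylinder_append, mem_cylinder_append, ha] at hi
        rw [hxs, zero_add]
        exact hi.1.2
      · simp only [Set.mem_iInter, Set.mem_compl_iff, hxs]
        intro u hu p hp hpu
        have e1 : i + ((p + R).toNat : ℕ) = p + (i + R) := by omega
        have e2 : (a ++ w ++ b).length =
            (p + R).toNat + u.length + (w.length + R + R - (p + R).toNat - u.length) := by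
          simp only [List.length_append, ha, hb]
          omega
        refine hF u hu (window x i (p + R).toNat) (window x (i + ((p + R).toNat + u.length : ℕ))
          (w.length + R + R - (p + R).toNat - u.length)) ?_
        rw [mem_cylinder_iff_eq_window.1 hi, e2, window_add, window_add, e1,
          ← mem_cylinder_iff_eq_window.1 hpu]
    obtain ⟨x, hx⟩ := IsCompact.nonempty_iInter_of_sequence_nonempty_isCompact_isClosed K
      (fun R x hx => ⟨hx.1, hx.2.1, by
        have := hx.2.2
        simp only [Set.mem_iInter, Set.mem_compl_iff] at this ⊢
        intro u hu p hp
        exact this u hu p ⟨by push_cast; omega, by push_cast; omega⟩⟩)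
      hKn (hX.1.of_isClosed_subset (hKc 0) Set.inter_subset_left) hKc
    rw [Set.mem_iInter] at hx
    refine hw ⟨x, ⟨(hx 0).1, fun u hu p hp => ?_⟩, 0, (hx 0).2.1⟩
    -- A margin wide enough to contain the supposed occurrence of `u` at `p`.
    have := (hx (p.natAbs + (p + u.length).natAbs)).2.2
    simp only [Set.mem_iInter, Set.mem_compl_iff] at this
    exact this u hu p ⟨by omega, by omega⟩ hp
  · rintro ⟨R, hR⟩ ⟨x, hx, p, hp⟩
    obtain ⟨u, hu, q, -, -, hq⟩ := hR.exists_occurrence hs hx.1 hp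
    exact hx.2 u hu q hq

end Subshifts

/-! ### Limit sets, recurrence and isolated points -/

section LimitSets

variable {X : Set (ℤ → ℕ)} {x y : ℤ → ℕ} {l : Filter ℤ}

/-- The set of limits of the points `σ ^ t (x)` along a filter of times `t`. -/
def limitSet (l : Filter ℤ) (x : ℤ → ℕ) : Set (ℤ → ℕ) :=
  {y | MapClusterPt y l fun t => shift t x}

theorem isClosed_limitSet (l : Filter ℤ) (x : ℤ → ℕ) : IsClosed (limitSet l x) :=
  isClosed_setOfPred_clusterPt

theorem IsSubshift.limitSet_subset (hX : IsSubshift X) (hx : x ∈ X) : limitSet l x ⊆ X :=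
  fun _ hy => hX.1.isClosed.mem_of_mapClusterPt hy (Eventually.of_forall fun t => hX.shift_mem hx t)

theorem IsSubshift.limitSet (hX : IsSubshift X) (hx : x ∈ X)
    (hl : ∀ c : ℤ, Tendsto (fun t => c + t) l l) : IsSubshift (limitSet l x) := by
  refine hX.of_isClosed (hX.limitSet_subset hx) (isClosed_limitSet l x) fun y hy n => ?_
  have h1 : MapClusterPt (shift n y) l (shift n ∘ fun t => shift t x) :=
    MapClusterPt.continuousAt_comp (continuous_shift n).continuousAt hy
  have h2 : (shift n ∘ fun t => shift t x) = (fun t => shift t x) ∘ fun t => n + t := by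
    funext t
    simp [shift_shift]
  rw [h2] at h1
  exact h1.of_comp (hl n)

/-- Openness of `U` gives one direction, compactness of `X ∩ U` the other. -/
theorem IsSubshift.exists_mem_limitSet_iff (hX : IsSubshift X) (hx : x ∈ X)
    {U : Set (ℤ → ℕ)} (hU : IsClopen U) :
    (∃ y ∈ ZSubshift.limitSet l x, y ∈ U) ↔ ∃ᶠ t in l, shift t x ∈ U := by
  constructor
  · rintro ⟨y, hy, hyU⟩
    exact hy.frequently (hU.isOpen.mem_nhds hyU)
  · intro h
    obtain ⟨y, hy, hyl⟩ := (hX.1.inter_right hU.isClosed).exists_mapClusterPt_of_frequently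
      (h.mono fun t ht => ⟨hX.shift_mem hx t, ht⟩)
    exact ⟨y, hyl, hy.2⟩

theorem IsSubshift.mem_language_limitSet_iff (hX : IsSubshift X) (hx : x ∈ X)
    (hl : ∀ c : ℤ, Tendsto (fun t => c + t) l l) {w : List ℕ} :
    w ∈ language (ZSubshift.limitSet l x) ↔ ∃ᶠ t in l, x ∈ cylinder t w := by
  have h0 := hX.exists_mem_limitSet_iff hx (l := l) (isClopen_cylinder 0 w)
  simp only [shift_mem_cylinder, zero_add] at h0
  rw [← h0]
  constructor
  · rintro ⟨y, hy, i, hi⟩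
    refine ⟨shift i y, (hX.limitSet hx hl).shift_mem hy i, ?_⟩
    rwa [shift_mem_cylinder, zero_add]
  · rintro ⟨y, hy, hw⟩
    exact ⟨y, hy, 0, hw⟩

theorem tendsto_const_add_atTop_int (c : ℤ) : Tendsto (fun t : ℤ => c + t) atTop atTop :=
  tendsto_atTop_add_const_left _ _ tendsto_id

theorem tendsto_const_add_atBot_int (c : ℤ) : Tendsto (fun t : ℤ => c + t) atBot atBot :=
  tendsto_atBot_add_const_left _ _ tendsto_id

/-- Along `⊤` every single time counts, so `limitSet ⊤ x` is the orbit closure of `x`. -/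
theorem self_mem_limitSet_top (x : ℤ → ℕ) : x ∈ limitSet ⊤ x := by
  refine mapClusterPt_iff_frequently.2 fun U hU => frequently_top.2 ⟨0, ?_⟩
  rw [shift_zero]
  exact mem_of_mem_nhds hU

/-- A point that is not a limit of its orbit in either direction is the only point of its orbit in
some cylinder. -/
theorem exists_isolating_cylinder (h1 : x ∉ limitSet atBot x) (h2 : x ∉ limitSet atTop x) :
    ∃ (p : ℤ) (u : List ℕ), ∀ q, x ∈ cylinder q u ↔ q = p := by
  have ev : ∀ l : Filter ℤ, x ∉ limitSet l x → ∃ U ∈ 𝓝 x, ∀ᶠ t in l, shift t x ∉ U := by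
    intro l hl
    simpa [limitSet, mapClusterPt_iff_frequently] using hl
  obtain ⟨U, hU, hU'⟩ := ev _ h1
  obtain ⟨V, hV, hV'⟩ := ev _ h2
  obtain ⟨m, hm⟩ := eventually_atBot.1 hU'
  obtain ⟨n, hn⟩ := eventually_atTop.1 hV'
  -- A periodic point would return to itself beyond `m` or `n`.
  have hper : ∀ t : ℤ, t ≠ 0 → shift t x ≠ x := by
    intro t ht he
    have hk : ∀ k : ℕ, shift (k * t) x = x := by
      intro k
      induction k with
      | zero => simp [shift_zero]
      | succ k ih =>
        have : ((k + 1 : ℕ) : ℤ) * t = k * t + t := by push_cast; ring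
        rw [this, ← shift_shift, he, ih]
    have hU0 := mem_of_mem_nhds hU
    have hV0 := mem_of_mem_nhds hV
    rcases lt_or_gt_of_ne ht with h | h
    · refine hm ((m.natAbs : ℕ) * t) ?_ (by rw [hk]; exact hU0)
      nlinarith [abs_nonneg m, neg_abs_le m, Int.natCast_natAbs m]
    · refine hn ((n.natAbs : ℕ) * t) ?_ (by rw [hk]; exact hV0)
      nlinarith [abs_nonneg n, le_abs_self n, Int.natCast_natAbs n]
  -- Returns close to `x` can only happen between `m` and `n`; these finitely many points differ
  -- from `x` and are cut away.
  have hfin : ((fun t => shift t x) '' (Set.Icc m n \ {0})).Finite :=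
    (Set.finite_Icc m n).sdiff.image _
  have hW : interior U ∩ interior V ∩ ((fun t => shift t x) '' (Set.Icc m n \ {0}))ᶜ ∈ 𝓝 x := by
    refine inter_mem (inter_mem (interior_mem_nhds.2 hU) (interior_mem_nhds.2 hV))
      (hfin.isClosed.compl_mem_nhds ?_)
    rintro ⟨t, ht, he⟩
    exact hper t ht.2 he
  obtain ⟨k, hk⟩ := exists_cylinder_subset isOpen_interior (mem_interior_iff_mem_nhds.2 hW)
  refine ⟨-k, window x (-k) (2 * k + 1), fun q => ⟨fun hq => ?_, ?_⟩⟩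
  · by_contra hne
    have h0 : shift (q + k) x ∈ cylinder (-(k : ℤ)) (window x (-k) (2 * k + 1)) := by
      rw [shift_mem_cylinder, show -(k : ℤ) + (q + k) = q by ring]
      exact hq
    have h3 := interior_subset (hk h0)
    have hlt : m < q + k := by
      by_contra! h
      exact hm _ h (interior_subset h3.1.1)
    have hgt : q + k < n := by
      by_contra! h
      exact hn _ h (interior_subset h3.1.2)
    exact h3.2 ⟨q + k, ⟨⟨hlt.le, hgt.le⟩, fun h => hne (by
      simp only [Set.mem_singleton_iff] at h; omega)⟩, rfl⟩
  · rintro rfl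
    exact self_mem_cylinder_window _ _ _

/-- A point whose orbit closure has an isolated point `x` dense in it is in the orbit of `x`. -/
theorem exists_shift_eq_of_isolating_cylinder {p : ℤ} {u : List ℕ}
    (hu : ∀ q, x ∈ cylinder q u ↔ q = p) (hy : y ∈ limitSet ⊤ x) (hx : x ∈ limitSet ⊤ y) :
    ∃ t, shift t y = x := by
  have hxu : x ∈ cylinder p u := (hu p).2 rfl
  obtain ⟨t, ht⟩ := frequently_top.1
    (MapClusterPt.frequently hx ((isClopen_cylinder p u).isOpen.mem_nhds hxu))
  refine ⟨t, ?_⟩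
  by_contra hne
  -- As `y` is in the orbit closure of `x`, the orbit of `x` would also enter this open set, but the
  -- isolating cylinder contains only `x` itself from that orbit.
  have hmem : shift t y ∈ cylinder p u ∩ {x}ᶜ := ⟨ht, hne⟩
  have hopen : IsOpen (shift t ⁻¹' (cylinder p u ∩ {x}ᶜ)) :=
    ((isClopen_cylinder p u).isOpen.inter isClosed_singleton.isOpen_compl).preimage
      (continuous_shift t)
  obtain ⟨r, hr⟩ := frequently_top.1 (MapClusterPt.frequently hy (hopen.mem_nhds hmem))
  have hr1 := hr.1
  have hr2 := hr.2
  rw [shift_shift] at hr1 hr2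
  rw [shift_mem_cylinder, hu] at hr1
  have : t + r = 0 := by omega
  rw [this, shift_zero] at hr2
  exact hr2 rfl

end LimitSets

/-! ### Decidability of the languages of subshifts of `X` -/

section LanguageDecidable

variable {X Y : Set (ℤ → ℕ)}

/-- The list of all words of length `n` over the alphabet `{0, …, s - 1}`. -/
def wordsOfLength (s n : ℕ) : List (List ℕ) :=
  Nat.rec [[]] (fun _ L => L.flatMap fun w => (List.range s).map fun c => c :: w) n

theorem mem_wordsOfLength {s n : ℕ} {w : List ℕ} :
    w ∈ wordsOfLength s n ↔ w.length = n ∧ ∀ c ∈ w, c < s := by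
  induction n generalizing w with
  | zero =>
    have : wordsOfLength s 0 = [[]] := rfl
    rw [this, List.mem_singleton, List.length_eq_zero_iff]
    exact ⟨fun h => ⟨h, by simp [h]⟩, fun h => h.1⟩
  | succ n ih =>
    have : wordsOfLength s (n + 1) =
      (wordsOfLength s n).flatMap fun w => (List.range s).map fun c => c :: w := rfl
    rw [this]
    simp only [List.mem_flatMap, ih, List.mem_map, List.mem_range]
    constructor
    · rintro ⟨v, ⟨h1, h2⟩, c, hc, rfl⟩
      exact ⟨by simp [h1], by simpa using ⟨hc, h2⟩⟩
    · rintro ⟨h1, h2⟩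
      rcases w with _ | ⟨c, v⟩
      · simp at h1
      · simp only [List.length_cons, Nat.add_right_cancel_iff] at h1
        simp only [List.mem_cons, forall_eq_or_imp] at h2
        exact ⟨v, ⟨h1, h2.2⟩, c, h2.1, rfl⟩

theorem computable_wordsOfLength (s : ℕ) : Computable (wordsOfLength s) := by
  have h : Primrec₂ fun (_ : ℕ) (y : ℕ × List (List ℕ)) =>
      y.2.flatMap fun w => (List.range s).map fun c => c :: w := by
    refine Primrec.list_flatMap (Primrec.snd.comp Primrec.snd) ?_
    exact Primrec.list_map (Primrec.const _)
      (Primrec.list_cons.comp Primrec.snd (Primrec.snd.comp Primrec.fst))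
  exact (Primrec.nat_rec' Primrec.id (Primrec.const [[]]) h).to_comp

theorem IsPi01.excludes_re (hpi : IsPi01 X) (s : ℕ) :
    REPred fun x : (List (List ℕ) × List ℕ) × ℕ => Excludes X s x.1.1 x.1.2 x.2 := by
  have h1 : REPred fun x : (((List (List ℕ) × List ℕ) × ℕ) × List ℕ) × List ℕ =>
      x.1.2 ++ x.1.1.1.2 ++ x.2 ∉ language X := by
    refine REPred.comp (p := fun w => w ∉ language X) hpi ?_
    fun_prop
  have h2 : REPred fun x : (((List (List ℕ) × List ℕ) × ℕ) × List ℕ) × List ℕ =>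
      ∃ u ∈ x.1.1.1.1, ∃ v z : List ℕ, v ++ u ++ z = x.1.2 ++ x.1.1.1.2 ++ x.2 := by
    refine REPred.exists_mem ?_ ?_
    · refine REPred.exists ?_
      refine REPred.exists ?_
      refine (ComputablePred.eq ?_ ?_).to_re <;>
      fun_prop
    · fun_prop
  have h3 : REPred fun x : (List (List ℕ) × List ℕ) × ℕ =>
      ∀ a ∈ wordsOfLength s x.2, ∀ b ∈ wordsOfLength s x.2, a ++ x.1.2 ++ b ∉ language X ∨
        ∃ u ∈ x.1.1, ∃ v z : List ℕ, v ++ u ++ z = a ++ x.1.2 ++ b := by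
    refine REPred.forall_mem ?_ ((computable_wordsOfLength s).comp Computable.snd)
    refine REPred.forall_mem ?_ ((computable_wordsOfLength s).comp
      (Computable.snd.comp Computable.fst))
    exact h1.or h2
  refine h3.of_eq fun x => ?_
  simp only [mem_wordsOfLength, Excludes, and_imp]

theorem IsPi01.notMem_language_avoid_re (hX : IsSubshift X) (hpi : IsPi01 X) :
    REPred fun x : List (List ℕ) × List ℕ => x.2 ∉ language (avoid X x.1) := by
  obtain ⟨s, hs⟩ := hX.exists_letter_bound
  exact (hpi.excludes_re s).exists.of_eq fun x => (notMem_language_avoid_iff hX hs).symm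

/-- Every subshift of a quasiminimal `Π⁰₁` subshift has a decidable language. -/
theorem computablePred_mem_language (hX : IsSubshift X) (hq : IsQuasiminimal X) (hpi : IsPi01 X)
    (hY : IsSubshift Y) (hYX : Y ⊆ X) : ComputablePred fun w => w ∈ language Y := by
  obtain ⟨F, hF⟩ := exists_eq_avoid hX hq hY hYX
  have hre := hpi.notMem_language_avoid_re hX
  have : ∀ Z : Set (ℤ → ℕ), ∃ w, ¬ Y ⊆ Z → IsSubshift Z → w ∈ language Y ∧ w ∉ language Z := by
    intro Z
    by_cases h : ¬ Y ⊆ Z ∧ IsSubshift Z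
    · obtain ⟨w, hw⟩ := h.2.exists_mem_language_notMem h.1
      exact ⟨w, fun _ _ => hw⟩
    · exact ⟨[], fun h1 h2 => (h ⟨h1, h2⟩).elim⟩
  choose f hf using this
  have hfin : {Z | (IsSubshift Z ∧ Z ⊆ X) ∧ ¬ Y ⊆ Z}.Finite :=
    hq.finite_subshifts.subset fun Z hZ => hZ.1
  -- The test words `f Z` occur in `Y`, and each misses a subshift `Z` that does not contain `Y`.
  -- Forbidding `w` kills one of them exactly when `w` occurs in `Y`.
  have hpos : REPred fun w : List ℕ =>
      ∃ u ∈ hfin.toFinset.toList.map f, u ∉ language (avoid X (w :: F)) :=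
    REPred.exists_mem (hre.comp ((Computable.list_cons.comp Computable.fst
      (Computable.const F)).pair Computable.snd)) (Computable.const _)
  have hneg : REPred fun w : List ℕ => w ∉ language Y :=
    (hre.comp ((Computable.const F).pair Computable.id)).of_eq fun w => by rw [hF]; rfl
  refine ComputablePred.of_re (hpos.of_eq fun w => ?_) hneg fun _ => Iff.rfl
  simp only [List.mem_map, Finset.mem_toList, Set.Finite.mem_toFinset]
  constructor
  · rintro ⟨_, ⟨Z, hZ, rfl⟩, h⟩
    by_contra hw
    refine h (language_mono (subset_avoid hYX ?_) (hf Z hZ.2 hZ.1.1).1)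
    rintro v (_ | ⟨_, hv⟩)
    · exact hw
    · rw [hF]
      exact notMem_language_avoid hv
  · intro hw
    -- `avoid X (w :: F)` is then one of the `Z`, so its own test word is missing from it.
    have hZ : ¬ Y ⊆ avoid X (w :: F) := fun h =>
      notMem_language_avoid (X := X) (F := w :: F) (w := w) (by simp) (language_mono h hw)
    exact ⟨_, ⟨_, ⟨⟨hX.avoid _, fun x hx => hx.1⟩, hZ⟩, rfl⟩, (hf _ hZ (hX.avoid _)).2⟩

theorem IsSubshift.exists_mem_clopenSet_iff (hY : IsSubshift Y) {D : ClopenCode} :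
    (∃ y ∈ Y, y ∈ clopenSet D) ↔ ∃ w ∈ D.2, w ∈ language Y := by
  constructor
  · rintro ⟨y, hy, w, hw, h⟩
    exact ⟨w, hw, y, hy, _, h⟩
  · rintro ⟨w, hw, y, hy, i, h⟩
    refine ⟨shift (i - D.1) y, hY.shift_mem hy _, w, hw, ?_⟩
    rwa [shift_mem_cylinder, add_sub_cancel]

end LanguageDecidable

/-! ### Ordered visits and the greedy run -/

section Visits

variable {X : Set (ℤ → ℕ)} {x : ℤ → ℕ}

/-- The point `x` visits the clopen sets listed in `T` in order, at times `≥ t`. -/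
def VisitsFrom (x : ℤ → ℕ) : ℤ → List ClopenCode → Prop
  | _, [] => True
  | t, D :: T => ∃ s, t ≤ s ∧ shift s x ∈ clopenSet D ∧ VisitsFrom x (s + 1) T

theorem VisitsFrom.mono {s t : ℤ} (hst : s ≤ t) {T : List ClopenCode} (h : VisitsFrom x t T) :
    VisitsFrom x s T := by
  cases T with
  | nil => trivial
  | cons D T =>
    obtain ⟨r, hr, h⟩ := h
    exact ⟨r, hst.trans hr, h⟩

theorem visitsFrom_iff {t : ℤ} {T : List ClopenCode} :
    VisitsFrom x t T ↔ ∃ i : Fin T.length → ℤ, StrictMono i ∧ (∀ j, t ≤ i j) ∧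
      ∀ j, shift (i j) x ∈ clopenSet T[j] := by
  induction T generalizing t with
  | nil => exact ⟨fun _ => ⟨fun _ => 0, fun i => i.elim0, fun i => i.elim0, fun i => i.elim0⟩,
      fun _ => trivial⟩
  | cons D T ih =>
    simp only [VisitsFrom, ih]
    constructor
    · rintro ⟨s, hts, hs, i, hi, hsi, hv⟩
      refine ⟨Fin.cons (α := fun _ => ℤ) s i, ?_, ?_, ?_⟩
      · intro a b hab
        induction a using Fin.cases with
        | zero =>
          induction b using Fin.cases with
          | zero => exact absurd hab (lt_irrefl _)
          | succ b => simpa using (Int.lt_of_add_one_le (hsi b))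
        | succ a =>
          induction b using Fin.cases with
          | zero => exact absurd hab (Fin.not_lt_zero _)
          | succ b => simpa using hi (Fin.succ_lt_succ_iff.1 hab)
      · intro j
        induction j using Fin.cases with
        | zero => simpa using hts
        | succ j =>
          have := hsi j
          simp only [Fin.cons_succ]
          omega
      · intro j
        induction j using Fin.cases with
        | zero => simpa using hs
        | succ j => simpa using hv j
    · rintro ⟨i, hi, hti, hv⟩
      refine ⟨i 0, hti 0, by simpa using hv 0, fun j => i j.succ, ?_, fun j => ?_, fun j => ?_⟩
      · exact fun a b hab => hi (Fin.succ_lt_succ_iff.2 hab)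
      · exact Int.add_one_le_of_lt (hi (Fin.succ_pos j))
      · simpa using hv j.succ

theorem visitsInOrder_iff {T : List ClopenCode} :
    VisitsInOrder X T ↔ ∃ x ∈ X, ∃ t, VisitsFrom x t T := by
  simp only [VisitsInOrder, visitsFrom_iff]
  refine exists_congr fun x => and_congr_right fun _ => ?_
  constructor
  · rintro ⟨i, hi, h⟩
    obtain ⟨t, ht⟩ := (Set.finite_range i).bddBelow
    exact ⟨t, i, hi, fun j => ht ⟨j, rfl⟩, h⟩
  · rintro ⟨t, i, hi, -, h⟩
    exact ⟨i, hi, h⟩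

theorem VisitsFrom.shift {t c : ℤ} {T : List ClopenCode} (h : VisitsFrom x t T) :
    VisitsFrom (ZSubshift.shift c x) (t - c) T := by
  induction T generalizing t with
  | nil => trivial
  | cons D T ih =>
    obtain ⟨s, hs, h1, h2⟩ := h
    refine ⟨s - c, by omega, ?_, ?_⟩
    · rwa [shift_shift, sub_add_cancel]
    · have := ih h2
      rwa [add_sub_right_comm] at this

theorem visitsFrom_of_meets_atTop
    (T : List ClopenCode) (h : ∀ D ∈ T, ∃ᶠ t in atTop, shift t x ∈ clopenSet D) (t : ℤ) :
    VisitsFrom x t T := by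
  induction T generalizing t with
  | nil => trivial
  | cons D T ih =>
    obtain ⟨s, hs, h1⟩ := frequently_atTop.1 (h D (by simp)) t
    exact ⟨s, hs, h1, ih (fun E hE => h E (by simp [hE])) _⟩

/-- However early the visits to the later sets begin, there is a still earlier visit to the set put
in front. -/
theorem exists_visitsFrom_append_of_meets_atBot (T₁ T₂ : List ClopenCode)
    (h : ∀ D ∈ T₁, ∃ᶠ t in atBot, shift t x ∈ clopenSet D) (h2 : ∃ t, VisitsFrom x t T₂) :
    ∃ t, VisitsFrom x t (T₁ ++ T₂) := by
  induction T₁ with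
  | nil => exact h2
  | cons D T ih =>
    obtain ⟨t, ht⟩ := ih fun E hE => h E (by simp [hE])
    obtain ⟨s, hs, h1⟩ := frequently_atBot.1 (h D (by simp)) (t - 1)
    exact ⟨s, s, le_rfl, h1, ht.mono (by omega)⟩

theorem VisitsFrom.of_append {T₁ T₂ : List ClopenCode} {t : ℤ}
    (h : VisitsFrom x t (T₁ ++ T₂)) : VisitsFrom x t T₂ := by
  induction T₁ generalizing t with
  | nil => exact h
  | cons D T ih =>
    obtain ⟨s, hs, -, h⟩ := h
    exact (ih h).mono (by omega)

theorem VisitsFrom.exists_visit {T : List ClopenCode} {t : ℤ} (h : VisitsFrom x t T) :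
    ∀ D ∈ T, ∃ s, t ≤ s ∧ ZSubshift.shift s x ∈ clopenSet D := by
  induction T generalizing t with
  | nil => simp
  | cons E T ih =>
    obtain ⟨s, hs, h1, h2⟩ := h
    intro D hD
    rcases List.mem_cons.1 hD with rfl | hD
    · exact ⟨s, hs, h1⟩
    · obtain ⟨r, hr, h⟩ := ih h2 D hD
      exact ⟨r, by omega, h⟩

open Classical in
/-- The clopen sets of the list `T` that are still to be visited when `x` has been observed at time
`t`. -/
noncomputable def visitStep (x : ℤ → ℕ) (t : ℤ) (T : List ClopenCode) : List ClopenCode :=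
  match T with
  | [] => []
  | D :: T => if shift t x ∈ clopenSet D then T else D :: T

/-- The clopen sets of the list `T` that are still to be visited when `x` has been observed at the
times `s, …, s + n - 1`. -/
noncomputable def visitRun (x : ℤ → ℕ) (s : ℤ) (T : List ClopenCode) (n : ℕ) : List ClopenCode :=
  Nat.rec T (fun k R => visitStep x (s + k) R) n

/-- Greed is optimal: using a visit as soon as it is available never hurts. -/
theorem visitsFrom_visitStep {t : ℤ} {T : List ClopenCode} :
    VisitsFrom x (t + 1) (visitStep x t T) ↔ VisitsFrom x t T := by
  rcases T with _ | ⟨D, T⟩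
  · rfl
  simp only [visitStep]
  split_ifs with hD
  · constructor
    · exact fun h => ⟨t, le_rfl, hD, h⟩
    · rintro ⟨s, hs, -, h⟩
      exact h.mono (by omega)
  · constructor
    · exact fun h => h.mono (by omega)
    · rintro ⟨s, hs, h1, h⟩
      refine ⟨s, ?_, h1, h⟩
      have : s ≠ t := by
        rintro rfl
        exact hD h1
      omega

theorem visitsFrom_visitRun {s : ℤ} {T : List ClopenCode} {n : ℕ} :
    VisitsFrom x (s + n) (visitRun x s T n) ↔ VisitsFrom x s T := by
  induction n with
  | zero => simp [visitRun]
  | succ n ih =>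
    rw [← ih, ← visitsFrom_visitStep (t := s + n), Nat.cast_succ, ← add_assoc]
    rfl

theorem visitRun_subset {s : ℤ} {T : List ClopenCode} {n : ℕ} : visitRun x s T n ⊆ T := by
  induction n with
  | zero => exact List.Subset.refl _
  | succ n ih =>
    refine List.Subset.trans ?_ ih
    change visitStep x (s + n) (visitRun x s T n) ⊆ _
    rcases visitRun x s T n with _ | ⟨D, R⟩
    · exact List.Subset.refl _
    · simp only [visitStep]
      split_ifs
      · exact List.subset_cons_self _ _
      · exact List.Subset.refl _

theorem visitRun_add {s : ℤ} {T : List ClopenCode} {m n : ℕ} :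
    visitRun x s T (m + n) = visitRun x (s + m) (visitRun x s T m) n := by
  induction n with
  | zero => rfl
  | succ n ih =>
    change visitStep x (s + (m + n : ℕ)) (visitRun x s T (m + n)) =
      visitStep x (s + m + n) (visitRun x (s + m) (visitRun x s T m) n)
    rw [ih, Nat.cast_add, add_assoc]

theorem visitsFrom_iff_visitRun_eq_nil {s : ℤ} {T : List ClopenCode} :
    VisitsFrom x s T ↔ ∃ n, visitRun x s T n = [] := by
  constructor
  · intro h
    induction T generalizing s with
    | nil => exact ⟨0, rfl⟩
    | cons D T ih =>
      classical
      obtain ⟨t, hst, h1, h2⟩ := h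
      have hex : ∃ k : ℕ, shift (s + k) x ∈ clopenSet D := by
        refine ⟨(t - s).toNat, ?_⟩
        rwa [show s + ((t - s).toNat : ℤ) = t by omega]
      have hk : Nat.find hex ≤ (t - s).toNat := by
        refine Nat.find_min' hex ?_
        rwa [show s + ((t - s).toNat : ℤ) = t by omega]
      have hrun : ∀ k ≤ Nat.find hex, visitRun x s (D :: T) k = D :: T := by
        intro k hk
        induction k with
        | zero => rfl
        | succ k ih =>
          change visitStep x (s + k) (visitRun x s (D :: T) k) = _
          rw [ih (by omega)]
          simp only [visitStep]
          rw [if_neg (Nat.find_min hex (by omega))]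
      have hrun' : visitRun x s (D :: T) (Nat.find hex + 1) = T := by
        change visitStep x (s + (Nat.find hex : ℕ)) (visitRun x s (D :: T) (Nat.find hex)) = _
        rw [hrun _ le_rfl]
        simp only [visitStep]
        rw [if_pos (Nat.find_spec hex)]
      obtain ⟨n, hn⟩ := ih (h2.mono (s := s + (Nat.find hex + 1 : ℕ)) (by push_cast; omega))
      exact ⟨Nat.find hex + 1 + n, by rw [visitRun_add, hrun', hn]⟩
  · rintro ⟨n, hn⟩
    rw [← visitsFrom_visitRun (n := n), hn]
    trivial

end Visits

/-! ### Deciding ordered visits of a computable orbit -/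

section IsolatedPoints

variable {X : Set (ℤ → ℕ)} {x : ℤ → ℕ}

/-- As `u` occurs in `x` only at `p`, a word of the language that contains `u` has a unique position
in `x`, and so do its subwords. A false claim is refuted by finding the true word of that length. -/
theorem computablePred_mem_cylinder {p : ℤ} {u : List ℕ} (hX : IsSubshift X) (hx : x ∈ X)
    (hu : ∀ q, x ∈ cylinder q u ↔ q = p)
    (hL : ComputablePred fun w => w ∈ language (limitSet ⊤ x)) :
    ComputablePred fun y : List ℕ × ℤ => x ∈ cylinder y.2 y.1 := by
  have hlang : ∀ w, w ∈ language (limitSet ⊤ x) ↔ ∃ t, x ∈ cylinder t w := fun w =>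
    (hX.mem_language_limitSet_iff hx fun _ => tendsto_top).trans frequently_top
  have hpos : REPred fun y : List ℕ × ℤ => x ∈ cylinder y.2 y.1 := by
    have h1 : REPred fun y : ((((List ℕ × ℤ) × List ℕ) × List ℕ) × List ℕ) × List ℕ =>
        -- If the common word starts at `t`, then `u` sits at `p = t + |a|` and `w` at `q = t +
        -- |v|`; eliminating `t` gives the last equation.
        y.1.1.1.2 ++ u ++ y.1.1.2 ∈ language (limitSet ⊤ x) ∧
          y.1.2 ++ y.1.1.1.1.1 ++ y.2 = y.1.1.1.2 ++ u ++ y.1.1.2 ∧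
            y.1.1.1.1.2 + y.1.1.1.2.length = p + y.1.2.length := by
      refine REPred.and (REPred.comp (p := fun w => w ∈ language (limitSet ⊤ x)) hL.to_re ?_)
        (REPred.and (ComputablePred.eq ?_ ?_).to_re (ComputablePred.eq ?_ ?_).to_re) <;>
      fun_prop
    have h2 : REPred fun y : List ℕ × ℤ => ∃ a b v z : List ℕ,
        a ++ u ++ b ∈ language (limitSet ⊤ x) ∧ v ++ y.1 ++ z = a ++ u ++ b ∧
          y.2 + a.length = p + v.length := by
      refine REPred.exists ?_
      refine REPred.exists ?_
      refine REPred.exists ?_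
      refine REPred.exists ?_
      exact h1
    refine h2.of_eq ?_
    rintro ⟨w, q⟩
    simp only [hlang]
    constructor
    · rintro ⟨a, b, v, z, ⟨t, ht⟩, heq, hlen⟩
      have h2 := ht
      rw [mem_cylinder_append, mem_cylinder_append, hu] at h2
      rw [← heq, mem_cylinder_append, mem_cylinder_append] at ht
      rw [show q = t + v.length by omega]
      exact ht.1.2
    · intro hw
      have hm : ∃ m : ℤ, m ≤ p ∧ m ≤ q := ⟨min p q, min_le_left _ _, min_le_right _ _⟩
      have hn : ∃ n : ℤ, p + u.length ≤ n ∧ q + w.length ≤ n :=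
        ⟨max (p + u.length) (q + w.length), le_max_left _ _, le_max_right _ _⟩
      obtain ⟨m, hmp, hmq⟩ := hm
      obtain ⟨n, hnp, hnq⟩ := hn
      have key : ∀ (r : ℤ) (v : List ℕ), x ∈ cylinder r v → m ≤ r → r + v.length ≤ n →
          window x m (r - m).toNat ++ v ++
            window x (r + v.length) (n - r - v.length).toNat = window x m (n - m).toNat := by
        intro r v hv hr hrn
        have e1 : (n - m).toNat = (r - m).toNat + v.length + (n - r - v.length).toNat := by omega
        have e2 : m + ((r - m).toNat : ℕ) = r := by omega
        have e3 : m + ((r - m).toNat + v.length : ℕ) = r + v.length := by omega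
        rw [e1, window_add, window_add, e3, e2, ← mem_cylinder_iff_eq_window.1 hv]
      have hpu := key p u ((hu p).2 rfl) hmp hnp
      refine ⟨window x m (p - m).toNat, window x (p + u.length) (n - p - u.length).toNat,
        window x m (q - m).toNat, window x (q + w.length) (n - q - w.length).toNat,
        ⟨m, ?_⟩, (key q w hw hmq hnq).trans hpu.symm, ?_⟩
      · rw [hpu]
        exact self_mem_cylinder_window _ _ _
      · simp only [length_window]
        omega
  have hneg : REPred fun y : List ℕ × ℤ =>
      ∃ w : List ℕ, x ∈ cylinder y.2 w ∧ w.length = y.1.length ∧ ¬ w = y.1 := by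
    refine REPred.exists ?_
    refine REPred.and (REPred.comp (p := fun y : List ℕ × ℤ => x ∈ cylinder y.2 y.1)
      (f := fun y : (List ℕ × ℤ) × List ℕ => (y.2, y.1.2)) hpos ?_)
      (REPred.and (ComputablePred.eq ?_ ?_).to_re (ComputablePred.eq ?_ ?_).not_re) <;>
    fun_prop
  refine ComputablePred.of_re hpos hneg ?_
  rintro ⟨w, q⟩
  constructor
  · rintro ⟨v, hv, hlen, hne⟩ hw
    exact hne (by rw [mem_cylinder_iff_eq_window.1 hv, hlen, ← mem_cylinder_iff_eq_window.1 hw])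
  · intro hw
    exact ⟨window x q w.length, self_mem_cylinder_window _ _ _, length_window _ _ _,
      fun h => hw (mem_cylinder_iff_eq_window.2 h.symm)⟩

theorem computablePred_shift_mem_clopenSet
    (h : ComputablePred fun y : List ℕ × ℤ => x ∈ cylinder y.2 y.1) :
    ComputablePred fun y : ℤ × ClopenCode => shift y.1 x ∈ clopenSet y.2 := by
  have h1 : ComputablePred fun y : ℤ × ClopenCode => ∃ w ∈ y.2.2, x ∈ cylinder (y.2.1 + y.1) w := by
    refine ComputablePred.exists_mem ?_ (Computable.snd.comp Computable.snd)
    refine ComputablePred.comp (p := fun y : List ℕ × ℤ => x ∈ cylinder y.2 y.1)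
      (f := fun y : (ℤ × ClopenCode) × List ℕ => (y.2, y.1.2.1 + y.1.1)) h ?_
    fun_prop
  exact h1.of_eq fun y => shift_mem_clopenSet.symm

theorem computable_visitRun
    (h : ComputablePred fun y : ℤ × ClopenCode => shift y.1 x ∈ clopenSet y.2) :
    Computable fun y : (ℤ × List ClopenCode) × ℕ => visitRun x y.1.1 y.1.2 y.2 := by
  classical
  have hstep : Computable fun y : ℤ × List ClopenCode => visitStep x y.1 y.2 := by
    have hget : Computable fun y : ℤ × List ClopenCode => y.2[0]? :=
      Computable.list_getElem?.comp Computable.snd (Computable.const 0)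
    have hdec : Computable fun y : (ℤ × List ClopenCode) × ClopenCode =>
        decide (shift y.1.1 x ∈ clopenSet y.2) := by
      refine Computable.comp (f := fun y : ℤ × ClopenCode => decide (shift y.1 x ∈ clopenSet y.2))
        (g := fun y : (ℤ × List ClopenCode) × ClopenCode => (y.1.1, y.2)) h.decide ?_
      fun_prop
    have htail : Computable fun y : (ℤ × List ClopenCode) × ClopenCode => y.1.2.tail :=
      Primrec.list_tail.to_comp.comp (by fun_prop)
    have hcond : Computable₂ fun (y : ℤ × List ClopenCode) (D : ClopenCode) =>
        bif decide (shift y.1 x ∈ clopenSet D) then y.2.tail else y.2 :=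
      Computable.cond hdec htail (by fun_prop)
    refine (Computable.option_casesOn hget Computable.snd hcond).of_eq ?_
    rintro ⟨t, _ | ⟨D, T⟩⟩
    · rfl
    · by_cases hD : shift t x ∈ clopenSet D <;> simp [visitStep, hD]
  have hstep' : Computable₂ fun (y : (ℤ × List ClopenCode) × ℕ) (z : ℕ × List ClopenCode) =>
      visitStep x (y.1.1 + z.1) z.2 := by
    refine Computable.comp (f := fun y : ℤ × List ClopenCode => visitStep x y.1 y.2)
      (g := fun y : ((ℤ × List ClopenCode) × ℕ) × ℕ × List ClopenCode =>
        (y.1.1.1 + y.2.1, y.2.2)) hstep ?_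
    fun_prop
  exact Computable.nat_rec Computable.snd (Computable.snd.comp Computable.fst) hstep'

theorem forall_or_exists_split {α : Type*} (p : α → Prop) (T : List α) :
    (∀ a ∈ T, p a) ∨ ∃ T₁ a T₂, T₁ ++ a :: T₂ = T ∧ (∀ b ∈ T₁, p b) ∧ ¬ p a := by
  induction T with
  | nil => simp
  | cons c T ih =>
    by_cases hc : p c
    · rcases ih with h | ⟨T₁, a, T₂, rfl, h1, h2⟩
      · exact Or.inl (by simpa using ⟨hc, h⟩)
      · exact Or.inr ⟨c :: T₁, a, T₂, rfl, by simpa using ⟨hc, h1⟩, h2⟩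
    · exact Or.inr ⟨[], c, T, rfl, by simp, hc⟩

/-- If the orbit of `x` is computable and one can certify lower (upper) bounds for the visit times
of clopen sets that are not visited infinitely often in the past (future), then it is decidable
whether `x` visits given clopen sets in order. -/
theorem computablePred_visits_of_bounds
    (h : ComputablePred fun y : ℤ × ClopenCode => shift y.1 x ∈ clopenSet y.2)
    {B A : ClopenCode → ℤ → Prop} (hB : REPred fun y : ClopenCode × ℤ => B y.1 y.2)
    (hA : REPred fun y : ClopenCode × ℤ => A y.1 y.2)
    (hB₁ : ∀ D s, B D s → ∀ t, shift t x ∈ clopenSet D → s ≤ t)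
    (hB₂ : ∀ D, (¬ ∃ᶠ t in atBot, shift t x ∈ clopenSet D) → ∀ᶠ s in atBot, B D s)
    (hA₁ : ∀ D s, A D s → ∀ t, shift t x ∈ clopenSet D → t < s)
    (hA₂ : ∀ D, (¬ ∃ᶠ t in atTop, shift t x ∈ clopenSet D) → ∀ᶠ s in atTop, A D s) :
    ComputablePred fun T => ∃ t, VisitsFrom x t T := by
  have hrun := computable_visitRun h
  have hpos : REPred fun T : List ClopenCode => ∃ t, ∃ n, visitRun x t T n = [] := by
    refine REPred.exists ?_
    refine REPred.exists ?_
    refine (ComputablePred.eq ?_ (Computable.const [])).to_re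
    refine Computable.comp (f := fun y : (ℤ × List ClopenCode) × ℕ => visitRun x y.1.1 y.1.2 y.2)
      (g := fun y : (List ClopenCode × ℤ) × ℕ => ((y.1.2, y.1.1), y.2)) hrun ?_
    fun_prop
  -- Certificate of failure: all visits to `D` happen at times `≥ s`, and the greedy run for `D ::
  -- T₂` from `s` leaves pending a set `E` with no visits from time `s + n` on.
  have hneg : REPred fun T : List ClopenCode => ∃ T₁ : List ClopenCode, ∃ D : ClopenCode,
      ∃ T₂ : List ClopenCode, ∃ s : ℤ, ∃ n : ℕ, (T₁ ++ D :: T₂ = T ∧ B D s) ∧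
        ∃ E ∈ visitRun x s (D :: T₂) n, A E (s + n) := by
    have hrun' : Computable fun y : ((((List ClopenCode × List ClopenCode) × ClopenCode) ×
        List ClopenCode) × ℤ) × ℕ => visitRun x y.1.2 (y.1.1.1.2 :: y.1.1.2) y.2 := by
      refine Computable.comp (f := fun y : (ℤ × List ClopenCode) × ℕ => visitRun x y.1.1 y.1.2 y.2)
        (g := fun y : ((((List ClopenCode × List ClopenCode) × ClopenCode) ×
          List ClopenCode) × ℤ) × ℕ => ((y.1.2, y.1.1.1.2 :: y.1.1.2), y.2)) hrun ?_
      fun_prop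
    refine REPred.exists ?_
    refine REPred.exists ?_
    refine REPred.exists ?_
    refine REPred.exists ?_
    refine REPred.exists ?_
    refine REPred.and (REPred.and (ComputablePred.eq ?_ ?_).to_re ?_)
      (REPred.exists_mem ?_ hrun')
    · fun_prop
    · fun_prop
    · refine REPred.comp (p := fun y : ClopenCode × ℤ => B y.1 y.2)
        (f := fun y : ((((List ClopenCode × List ClopenCode) × ClopenCode) ×
          List ClopenCode) × ℤ) × ℕ => (y.1.1.1.2, y.1.2)) hB ?_
      fun_prop
    · refine REPred.comp (p := fun y : ClopenCode × ℤ => A y.1 y.2)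
        (f := fun y : (((((List ClopenCode × List ClopenCode) × ClopenCode) ×
          List ClopenCode) × ℤ) × ℕ) × ClopenCode => (y.2, y.1.1.2 + y.1.2)) hA ?_
      fun_prop
  refine ComputablePred.of_re (hpos.of_eq fun T => ?_) hneg fun T => ?_
  · simp only [visitsFrom_iff_visitRun_eq_nil]
  · constructor
    · rintro ⟨T₁, D, T₂, s, n, ⟨rfl, hBD⟩, E, hE, hAE⟩ ⟨t, ht⟩
      have h1 : VisitsFrom x s (D :: T₂) := by
        obtain ⟨r, -, hr, h2⟩ := ht.of_append
        exact ⟨r, hB₁ D s hBD r hr, hr, h2⟩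
      obtain ⟨r, hr, hrE⟩ := (visitsFrom_visitRun.2 h1).exists_visit E hE
      exact absurd (hA₁ E _ hAE r hrE) (not_lt.2 hr)
    · intro hT
      rcases forall_or_exists_split
        (fun D => ∃ᶠ t in atBot, shift t x ∈ clopenSet D) T with h1 | ⟨T₁, D, T₂, rfl, h1, h2⟩
      · refine (hT ?_).elim
        have := exists_visitsFrom_append_of_meets_atBot T [] h1 ⟨0, trivial⟩
        rwa [List.append_nil] at this
      · obtain ⟨s, hs⟩ := (hB₂ D h2).exists
        -- If at a late time `e` no pending set had a certificate, all pending sets would be visited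
        -- infinitely often in the future, and the run could be completed.
        have hfin : ∀ᶠ e in atTop, ∀ E ∈ {E | E ∈ D :: T₂},
            (¬ ∃ᶠ t in atTop, shift t x ∈ clopenSet E) → A E e := by
          rw [eventually_all_finite (List.finite_toSet (D :: T₂))]
          intro E _
          by_cases hE : ∃ᶠ t in atTop, shift t x ∈ clopenSet E
          · exact Eventually.of_forall fun _ h => (h hE).elim
          · exact (hA₂ E hE).mono fun _ h _ => h
        obtain ⟨e, he, hes⟩ := (hfin.and (eventually_ge_atTop s)).exists
        refine ⟨T₁, D, T₂, s, (e - s).toNat, ⟨rfl, hs⟩, ?_⟩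
        by_contra! hall
        refine hT (exists_visitsFrom_append_of_meets_atBot T₁ _ h1 ⟨s, ?_⟩)
        rw [← visitsFrom_visitRun (n := (e - s).toNat)]
        refine visitsFrom_of_meets_atTop _ (fun E hE => ?_) _
        by_contra hnot
        refine hall E hE ?_
        rw [show s + ((e - s).toNat : ℤ) = e by omega]
        exact he E (visitRun_subset hE) hnot

end IsolatedPoints

/-! ### Certified bounds and the case split by orbit closure -/

section Decidability

variable {X : Set (ℤ → ℕ)} {x : ℤ → ℕ}

theorem frequently_shift_mem_clopenSet {l : Filter ℤ} (hX : IsSubshift X) (hx : x ∈ X)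
    (hl : ∀ c : ℤ, Tendsto (fun t => c + t) l l) {D : ClopenCode} {w : List ℕ} (hw : w ∈ D.2)
    (h : w ∈ language (limitSet l x)) : ∃ᶠ t in l, shift t x ∈ clopenSet D := by
  rw [← hX.exists_mem_limitSet_iff hx (isClopen_clopenSet D),
    (hX.limitSet hx hl).exists_mem_clopenSet_iff]
  exact ⟨w, hw, h⟩

theorem eventually_notMem_cylinder {l : Filter ℤ} (hX : IsSubshift X) (hx : x ∈ X)
    (hl : ∀ c : ℤ, Tendsto (fun t => c + t) l l) {F : List (List ℕ)}
    (hF : limitSet l x = avoid X F) : ∀ᶠ q in l, ∀ u ∈ {u | u ∈ F}, x ∉ cylinder q u := by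
  rw [eventually_all_finite (List.finite_toSet F)]
  intro u hu
  have := (hX.mem_language_limitSet_iff hx hl).not.1 (hF ▸ notMem_language_avoid hu)
  simpa using this

/-- If `F` defines the past limit set, no word of `F` occurs in `x` at a position `≤ c`. A word `w`
excluded with margin `R` drags a word of `F` along, hence cannot occur far to the left of `c`. Both
`F` and `c` are constants of the algorithm. -/
theorem exists_certified_lower_bounds (hX : IsSubshift X) (hq : IsQuasiminimal X)
    (hpi : IsPi01 X) (hx : x ∈ X) : ∃ B : ClopenCode → ℤ → Prop,
      REPred (fun y : ClopenCode × ℤ => B y.1 y.2) ∧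
      (∀ D s, B D s → ∀ t, shift t x ∈ clopenSet D → s ≤ t) ∧
      ∀ D, (¬ ∃ᶠ t in atBot, shift t x ∈ clopenSet D) → ∀ᶠ s in atBot, B D s := by
  obtain ⟨m, hm⟩ := hX.exists_letter_bound
  obtain ⟨F, hF⟩ := exists_eq_avoid hX hq (hX.limitSet hx tendsto_const_add_atBot_int)
    (hX.limitSet_subset hx)
  obtain ⟨c, hc⟩ := eventually_atBot.1
    (eventually_notMem_cylinder hX hx tendsto_const_add_atBot_int hF)
  -- The slack `n` turns the inequality `s + D.1 + |w| + R ≤ c` into an equation.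
  refine ⟨fun D s => ∀ w ∈ D.2, ∃ R n : ℕ,
    Excludes X m F w R ∧ s + D.1 + w.length + R + n = c, ?_, ?_, ?_⟩
  · refine REPred.forall_mem ?_ (by fun_prop)
    refine REPred.exists ?_
    refine REPred.exists ?_
    refine REPred.and ?_ (ComputablePred.eq (by fun_prop) (by fun_prop)).to_re
    refine REPred.comp (p := fun y : (List (List ℕ) × List ℕ) × ℕ => Excludes X m y.1.1 y.1.2 y.2)
      (f := fun y : (((ClopenCode × ℤ) × List ℕ) × ℕ) × ℕ => ((F, y.1.1.2), y.1.2))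
      (hpi.excludes_re m) (by fun_prop)
  · intro D s h t ht
    obtain ⟨w, hw, hxw⟩ := shift_mem_clopenSet.1 ht
    obtain ⟨R, n, hE, hn⟩ := h w hw
    obtain ⟨u, hu, q, -, hq2, hqu⟩ := hE.exists_occurrence hm hx hxw
    have : c < q := by
      by_contra! hle
      exact hc q hle u hu hqu
    omega
  · intro D hD
    change ∀ᶠ s in atBot, ∀ w ∈ {w | w ∈ D.2}, _
    rw [eventually_all_finite (List.finite_toSet D.2)]
    intro w hw
    have hwL : w ∉ language (avoid X F) := fun h => hD
      (frequently_shift_mem_clopenSet hX hx tendsto_const_add_atBot_int hw (hF ▸ h))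
    obtain ⟨R, hR⟩ := (notMem_language_avoid_iff hX hm).1 hwL
    filter_upwards [eventually_le_atBot (c - D.1 - w.length - R)] with s hs
    exact ⟨R, (c - (s + D.1 + w.length + R)).toNat, hR, by omega⟩

theorem exists_certified_upper_bounds (hX : IsSubshift X) (hq : IsQuasiminimal X)
    (hpi : IsPi01 X) (hx : x ∈ X) : ∃ A : ClopenCode → ℤ → Prop,
      REPred (fun y : ClopenCode × ℤ => A y.1 y.2) ∧
      (∀ D s, A D s → ∀ t, shift t x ∈ clopenSet D → t < s) ∧
      ∀ D, (¬ ∃ᶠ t in atTop, shift t x ∈ clopenSet D) → ∀ᶠ s in atTop, A D s := by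
  obtain ⟨m, hm⟩ := hX.exists_letter_bound
  obtain ⟨F, hF⟩ := exists_eq_avoid hX hq (hX.limitSet hx tendsto_const_add_atTop_int)
    (hX.limitSet_subset hx)
  obtain ⟨c, hc⟩ := eventually_atTop.1
    (eventually_notMem_cylinder hX hx tendsto_const_add_atTop_int hF)
  refine ⟨fun D s => ∀ w ∈ D.2, ∃ R n : ℕ,
    Excludes X m F w R ∧ c + R + n = s + D.1, ?_, ?_, ?_⟩
  · refine REPred.forall_mem ?_ (by fun_prop)
    refine REPred.exists ?_
    refine REPred.exists ?_
    refine REPred.and ?_ (ComputablePred.eq (by fun_prop) (by fun_prop)).to_re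
    refine REPred.comp (p := fun y : (List (List ℕ) × List ℕ) × ℕ => Excludes X m y.1.1 y.1.2 y.2)
      (f := fun y : (((ClopenCode × ℤ) × List ℕ) × ℕ) × ℕ => ((F, y.1.1.2), y.1.2))
      (hpi.excludes_re m) (by fun_prop)
  · intro D s h t ht
    obtain ⟨w, hw, hxw⟩ := shift_mem_clopenSet.1 ht
    obtain ⟨R, n, hE, hn⟩ := h w hw
    obtain ⟨u, hu, q, hq1, -, hqu⟩ := hE.exists_occurrence hm hx hxw
    have : q < c := by
      by_contra! hle
      exact hc q hle u hu hqu
    omega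
  · intro D hD
    change ∀ᶠ s in atTop, ∀ w ∈ {w | w ∈ D.2}, _
    rw [eventually_all_finite (List.finite_toSet D.2)]
    intro w hw
    have hwL : w ∉ language (avoid X F) := fun h => hD
      (frequently_shift_mem_clopenSet hX hx tendsto_const_add_atTop_int hw (hF ▸ h))
    obtain ⟨R, hR⟩ := (notMem_language_avoid_iff hX hm).1 hwL
    filter_upwards [eventually_ge_atTop (c + R - D.1)] with s hs
    exact ⟨R, (s + D.1 - (c + R)).toNat, hR, by omega⟩

theorem computablePred_visits_of_not_recurrent (hX : IsSubshift X) (hq : IsQuasiminimal X)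
    (hpi : IsPi01 X) (hx : x ∈ X) (h1 : x ∉ limitSet atBot x) (h2 : x ∉ limitSet atTop x) :
    ComputablePred fun T => ∃ t, VisitsFrom x t T := by
  obtain ⟨p, u, hu⟩ := exists_isolating_cylinder h1 h2
  obtain ⟨B, hB, hB1, hB2⟩ := exists_certified_lower_bounds hX hq hpi hx
  obtain ⟨A, hA, hA1, hA2⟩ := exists_certified_upper_bounds hX hq hpi hx
  have hL := computablePred_mem_language hX hq hpi
    (hX.limitSet hx (l := ⊤) fun _ => tendsto_top) (hX.limitSet_subset hx)
  exact computablePred_visits_of_bounds (computablePred_shift_mem_clopenSet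
    (computablePred_mem_cylinder hX hx hu hL)) hB hA hB1 hB2 hA1 hA2

/-- If `x` recurs in one direction, its limit set there is the whole orbit closure, so each set
meeting the closure is visited infinitely often in that direction. -/
theorem exists_visitsFrom_iff_of_recurrent (hX : IsSubshift X) (hx : x ∈ X)
    (h : x ∈ limitSet atBot x ∨ x ∈ limitSet atTop x) {T : List ClopenCode} :
    (∃ t, VisitsFrom x t T) ↔ ∀ D ∈ T, ∃ y ∈ limitSet ⊤ x, y ∈ clopenSet D := by
  constructor
  · rintro ⟨t, ht⟩ D hD
    obtain ⟨s, -, hs⟩ := ht.exists_visit D hD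
    rw [hX.exists_mem_limitSet_iff hx (isClopen_clopenSet D), frequently_top]
    exact ⟨s, hs⟩
  · intro hT
    have hfreq : ∀ l : Filter ℤ, x ∈ limitSet l x → (∀ c : ℤ, Tendsto (fun t => c + t) l l) →
        ∀ D ∈ T, ∃ᶠ t in l, shift t x ∈ clopenSet D := by
      intro l hxl hl D hD
      obtain ⟨y, hy, hyD⟩ := hT D hD
      rw [← hX.exists_mem_limitSet_iff hx (isClopen_clopenSet D)]
      exact ⟨y, (hX.limitSet hx hl).limitSet_subset hxl hy, hyD⟩
    rcases h with h | h
    · have := exists_visitsFrom_append_of_meets_atBot T []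
        (hfreq _ h tendsto_const_add_atBot_int) ⟨0, trivial⟩
      rwa [List.append_nil] at this
    · exact ⟨0, visitsFrom_of_meets_atTop T (hfreq _ h tendsto_const_add_atTop_int) 0⟩

/-- Which case holds depends on `Y` alone and need not be decided. In the non-recurrent case all
points with closure `Y` form a single orbit, so one representative suffices. -/
theorem computablePred_visits_of_limitSet_eq (hX : IsSubshift X) (hq : IsQuasiminimal X)
    (hpi : IsPi01 X) {Y : Set (ℤ → ℕ)} (hY : IsSubshift Y) (hYX : Y ⊆ X) :
    ComputablePred fun T => ∃ x ∈ X, limitSet ⊤ x = Y ∧ ∃ t, VisitsFrom x t T := by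
  by_cases hex : ∃ x ∈ X, limitSet ⊤ x = Y ∧ x ∉ limitSet atBot x ∧ x ∉ limitSet atTop x
  · obtain ⟨x, hx, hxY, h1, h2⟩ := hex
    refine (computablePred_visits_of_not_recurrent hX hq hpi hx h1 h2).of_eq fun T => ?_
    refine ⟨fun h => ⟨x, hx, hxY, h⟩, ?_⟩
    rintro ⟨y, hy, hyY, t, ht⟩
    obtain ⟨p, u, hu⟩ := exists_isolating_cylinder h1 h2
    obtain ⟨c, rfl⟩ := exists_shift_eq_of_isolating_cylinder hu (y := y)
      (by rw [hxY, ← hyY]; exact self_mem_limitSet_top y)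
      (by rw [hyY, ← hxY]; exact self_mem_limitSet_top x)
    exact ⟨_, ht.shift⟩
  · have hrec : ∀ x ∈ X, limitSet ⊤ x = Y → x ∈ limitSet atBot x ∨ x ∈ limitSet atTop x := by
      intro x hx hxY
      by_contra! h
      exact hex ⟨x, hx, hxY, h⟩
    by_cases hne : ∃ x ∈ X, limitSet ⊤ x = Y
    · have hL := computablePred_mem_language hX hq hpi hY hYX
      have hmeet : ComputablePred fun T : List ClopenCode =>
          ∀ D ∈ T, ∃ w ∈ D.2, w ∈ language Y := by
        refine ComputablePred.forall_mem ?_ (by fun_prop)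
        refine ComputablePred.exists_mem ?_ (by fun_prop)
        exact ComputablePred.comp (p := fun w => w ∈ language Y) hL (by fun_prop)
      refine hmeet.of_eq fun T => ?_
      simp only [← hY.exists_mem_clopenSet_iff]
      constructor
      · intro h
        obtain ⟨x, hx, hxY⟩ := hne
        refine ⟨x, hx, hxY, (exists_visitsFrom_iff_of_recurrent hX hx (hrec x hx hxY)).2 ?_⟩
        rwa [hxY]
      · rintro ⟨x, hx, hxY, h⟩
        rw [← hxY]
        exact (exists_visitsFrom_iff_of_recurrent hX hx (hrec x hx hxY)).1 h
    · refine (ComputablePred.const False).of_eq fun T => ?_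
      simp only [false_iff]
      rintro ⟨x, hx, hxY, -⟩
      exact hne ⟨x, hx, hxY⟩

theorem computablePred_visitsInOrder (hX : IsSubshift X) (hq : IsQuasiminimal X)
    (hpi : IsPi01 X) : ComputablePred fun T => VisitsInOrder X T := by
  refine (ComputablePred.exists_mem_finite hq.finite_subshifts fun Y hY =>
    computablePred_visits_of_limitSet_eq hX hq hpi hY.1 hY.2).of_eq fun T => ?_
  rw [visitsInOrder_iff]
  constructor
  · rintro ⟨Y, -, x, hx, -, h⟩
    exact ⟨x, hx, h⟩
  · rintro ⟨x, hx, h⟩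
    exact ⟨limitSet ⊤ x, ⟨hX.limitSet hx fun _ => tendsto_top, hX.limitSet_subset hx⟩,
      x, hx, rfl, h⟩

/-! ### Reduction of halting and model checking to ordered visits -/

theorem halts_iff_visitsInOrder (hX : IsSubshift X) {C D : ClopenCode} :
    Halts X C D ↔ VisitsInOrder X [C, (D.1 + -1, D.2)] := by
  -- Halting permits `j = 0`, while visits are at strictly increasing times; moving `D` by one
  -- coordinate absorbs the difference.
  have hD : ∀ (t : ℤ) (y : ℤ → ℕ),
      shift t y ∈ clopenSet (D.1 + -1, D.2) ↔ shift (t - 1) y ∈ clopenSet D := by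
    intro t y
    simp only [shift_mem_clopenSet]
    rw [show D.1 + -1 + t = D.1 + (t - 1) by ring]
  rw [visitsInOrder_iff]
  simp only [VisitsFrom, hD, and_true, Halts]
  constructor
  · rintro ⟨x, hx, j, h1, h2⟩
    exact ⟨x, hx, 0, 0, le_rfl, by rwa [shift_zero], j + 1, by omega, by simpa using h2⟩
  · rintro ⟨x, hx, t, s, -, h1, r, hr, h2⟩
    refine ⟨shift s x, hX.shift_mem hx s, (r - 1 - s).toNat, h1, ?_⟩
    rwa [shift_shift, show ((r - 1 - s).toNat : ℤ) + s = r - 1 by omega]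

theorem computablePred_halts (hX : IsSubshift X) (hq : IsQuasiminimal X) (hpi : IsPi01 X) :
    ComputablePred fun CD : ClopenCode × ClopenCode => Halts X CD.1 CD.2 :=
  (ComputablePred.comp (computablePred_visitsInOrder hX hq hpi)
    (f := fun CD : ClopenCode × ClopenCode => [CD.1, (CD.2.1 + -1, CD.2.2)])
    (by fun_prop)).of_eq fun _ => (halts_iff_visitsInOrder hX).symm

/-- The default code `(0, [])` lists no words and so denotes the empty set, as `cell` does out of
range. -/
theorem cell_eq_clopenSet (P : List ClopenCode) (a : ℕ) :
    cell P a = clopenSet (P.getD a (0, [])) := by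
  ext x
  rw [List.getD_eq_getElem?_getD]
  rcases h : P[a]? with _ | C <;> simp [cell, clopenSet, h]

/-- The symbols of `w` name cells of `P` that contain the points `σ ^ t (x), σ ^ (t + 1) (x), …`. -/
def Codes (P : List ClopenCode) (x : ℤ → ℕ) (t : ℤ) (w : List ℕ) : Prop :=
  ∀ (i : ℕ) (hi : i < w.length), shift (t + i) x ∈ cell P w[i]

theorem codes_nil {P : List ClopenCode} {t : ℤ} : Codes P x t [] :=
  fun _ hi => (Nat.not_lt_zero _ hi).elim

theorem codes_cons {P : List ClopenCode} {t : ℤ} {a : ℕ} {w : List ℕ} :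
    Codes P x t (a :: w) ↔ shift t x ∈ cell P a ∧ Codes P x (t + 1) w := by
  constructor
  · intro h
    have h0 : shift (t + (0 : ℕ)) x ∈ cell P a := h 0 (by simp)
    rw [Nat.cast_zero, add_zero] at h0
    refine ⟨h0, fun i hi => ?_⟩
    have := h (i + 1) (by simpa using hi)
    rwa [List.getElem_cons_succ, Nat.cast_succ, add_comm (i : ℤ) 1, ← add_assoc] at this
  · rintro ⟨h1, h2⟩ (_ | i) hi
    · simpa using h1
    · rw [List.getElem_cons_succ, Nat.cast_succ, add_comm (i : ℤ) 1, ← add_assoc]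
      exact h2 i _

theorem codes_append {P : List ClopenCode} {t : ℤ} {v w : List ℕ} :
    Codes P x t (v ++ w) ↔ Codes P x t v ∧ Codes P x (t + v.length) w := by
  induction v generalizing t with
  | nil => simp [codes_nil]
  | cons a v ih =>
    rw [List.cons_append, codes_cons, codes_cons, ih, and_assoc, List.length_cons, Nat.cast_succ,
      add_comm (v.length : ℤ) 1, add_assoc]

theorem IsClopenPartition.exists_codes {P : List ClopenCode} (hP : IsClopenPartition X P)
    (hX : IsSubshift X) (hx : x ∈ X) (n : ℕ) (t : ℤ) :
    ∃ v ∈ allWords P.length, v.length = n ∧ Codes P x t v := by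
  induction n generalizing t with
  | zero => exact ⟨[], fun a ha => by simp at ha, rfl, codes_nil⟩
  | succ n ih =>
    obtain ⟨v, hv, hlen, hc⟩ := ih (t + 1)
    obtain ⟨a, ⟨ha, hxa⟩, -⟩ := hP _ (hX.shift_mem hx t)
    refine ⟨a :: v, fun b hb => ?_, by simp [hlen], codes_cons.2 ⟨hxa, hc⟩⟩
    rcases List.mem_cons.1 hb with rfl | hb
    · exact ha
    · exact hv b hb

/-- The orbit of `x` from time `t` on is coded by some word of the language `elementaryPT` if and
only if `x` visits the corresponding cells in order, starting at time `t`. -/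
theorem IsClopenPartition.exists_mem_elementaryPT_iff {P : List ClopenCode}
    (hP : IsClopenPartition X P) (hX : IsSubshift X) (hx : x ∈ X) (a : ℕ) (l : List ℕ) (t : ℤ) :
    (∃ w ∈ elementaryPT P.length (a :: l), Codes P x t w) ↔
      shift t x ∈ cell P a ∧ VisitsFrom x (t + 1) (l.map fun b => P.getD b (0, [])) := by
  induction l generalizing a t with
  | nil =>
    constructor
    · rintro ⟨w, rfl, hw⟩
      exact ⟨(codes_cons.1 hw).1, trivial⟩
    · rintro ⟨h, -⟩
      exact ⟨[a], rfl, codes_cons.2 ⟨h, codes_nil⟩⟩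
  | cons b l ih =>
    constructor
    · rintro ⟨_, ⟨_, ⟨_, rfl, v, hv, rfl⟩, w, hw, rfl⟩, h⟩
      simp only [codes_append, codes_cons, List.length_append, List.length_singleton] at h
      obtain ⟨⟨⟨h1, -⟩, -⟩, h2⟩ := h
      obtain ⟨h3, h4⟩ := (ih b _).1 ⟨w, hw, h2⟩
      refine ⟨h1, _, ?_, by rwa [← cell_eq_clopenSet], h4⟩
      push_cast
      omega
    · rintro ⟨h1, s, hs, h2, h3⟩
      rw [← cell_eq_clopenSet] at h2
      obtain ⟨w, hw, hc⟩ := (ih b s).2 ⟨h2, h3⟩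
      -- The cells cover `X`, so the gap between two visits is always coded by some word over the
      -- full alphabet.
      obtain ⟨v, hv, hlen, hcv⟩ := hP.exists_codes hX hx (s - (t + 1)).toNat (t + 1)
      refine ⟨[a] ++ v ++ w, ⟨_, ⟨_, rfl, v, hv, rfl⟩, w, hw, rfl⟩, ?_⟩
      rw [codes_append, codes_append, codes_cons]
      refine ⟨⟨⟨h1, codes_nil⟩, by simpa using hcv⟩, ?_⟩
      rw [show t + (([a] ++ v).length : ℕ) = s by
        simp only [List.length_append, List.length_singleton, hlen]; omega]
      exact hc

theorem modelCheckingDecidable_elementaryPT (hX : IsSubshift X) (hq : IsQuasiminimal X)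
    (hpi : IsPi01 X) : ModelCheckingDecidable X IsEPTCode elementaryPT := by
  classical
  have hcells : Computable fun y : List ClopenCode × List ℕ =>
      y.2.map fun b => y.1.getD b ((0, []) : ClopenCode) := by
    have h : Primrec₂ fun (y : List ClopenCode × List ℕ) (b : ℕ) =>
        y.1.getD b ((0, []) : ClopenCode) :=
      (Primrec.list_getD ((0, []) : ClopenCode)).comp (Primrec.fst.comp Primrec.fst) Primrec.snd
    exact (Primrec.list_map Primrec.snd h).to_comp
  refine ⟨_, (computablePred_visitsInOrder hX hq hpi).decide.comp hcells, ?_⟩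
  rintro P (_ | ⟨a, l⟩) hP hc
  · exact (hc.1 rfl).elim
  rw [decide_eq_true_iff, visitsInOrder_iff, List.map_cons]
  have hcodes : ∀ y w, Codes P y 0 w ↔ ∀ (i : ℕ) (hi : i < w.length),
      shift (i : ℤ) y ∈ cell P w[i] := by
    intro y w
    simp only [Codes, zero_add]
  simp only [← hcodes]
  constructor
  · rintro ⟨x, hx, t, s, -, h1, h2⟩
    rw [← cell_eq_clopenSet] at h1
    obtain ⟨w, hw, hcw⟩ := (hP.exists_mem_elementaryPT_iff hX hx a l s).2 ⟨h1, h2⟩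
    refine ⟨w, hw, shift s x, hX.shift_mem hx s, fun i hi => ?_⟩
    rw [shift_shift, zero_add, add_comm]
    exact hcw i hi
  · rintro ⟨w, hw, x, hx, hcw⟩
    obtain ⟨h1, h2⟩ := (hP.exists_mem_elementaryPT_iff hX hx a l 0).1 ⟨w, hw, hcw⟩
    exact ⟨x, hx, 0, 0, le_rfl, by rwa [← cell_eq_clopenSet], h2⟩

end Decidability

end ZSubshift

theorem mainTheorem5 (X : Set (ℤ → ℕ)) (hX : ZSubshift.IsSubshift X)
    (hq : ZSubshift.IsQuasiminimal X) (hpi : ZSubshift.IsPi01 X) :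
    ZSubshift.ModelCheckingDecidable X ZSubshift.IsEPTCode ZSubshift.elementaryPT ∧
      ComputablePred (fun T : List ZSubshift.ClopenCode => ZSubshift.VisitsInOrder X T) ∧
      ComputablePred (fun CD : ZSubshift.ClopenCode × ZSubshift.ClopenCode =>
        ZSubshift.Halts X CD.1 CD.2) :=
  ⟨ZSubshift.modelCheckingDecidable_elementaryPT hX hq hpi,
    ZSubshift.computablePred_visitsInOrder hX hq hpi, ZSubshift.computablePred_halts hX hq hpi⟩
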